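/- **Model.** There are $n$ participants, of which a set of at most $\rho n$ is corrupt. The execution proceeds in rounds and uses a random oracle whose answers to new queries are independent and uniform on $\{0,\dots,N-1\}$ (for example $N=2^\kappa$), where hash references are ideal: a reference determines the referenced block, and a block can be referenced only once it exists. In each round, (1) each honest participant receives existing blocks chosen, and put in order, by the adversary, and gets transactions from the environment (which is merged with the adversary); (2) each honest participant makes one query; if it finds a block, it broadcasts it together with all non-genesis blocks on which its acceptance depends; (3) the adversary, who sees all broadcast blocks, makes up to $\lfloor\rho n\rfloor$ sequential adaptive queries and sees their answers. Adversaries are randomized strategies without computational bound. The adversary is *$\Delta$-bounded* if everything broadcast by an honest participant in round $t$ has been received by all honest participants in round $t+\Delta$ at the latest. *Nakamoto consensus* $\Pi_{nak}$ *in the $(\rho,\Delta,n,p)$-environment*, $p=d/N$: a query contains a parent and transactions and yields a block if the hash value is $<d$ (a prescribed number of leading zeros when $N$ and $d$ are powers of two). A received block is accepted once its parent is accepted. Participants mine on a longest accepted chain, keeping the first one that arrived. *Eunomia* $\Pi_{enu}$ *in the $(m,\rho,\Delta,n,mp)$-environment*, where $m\ge1$, $m\mid N$ and $mp\le1$: a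 query contains, for each $j\in\{0,\dots,m-1\}$, a reference to a block and transactions for chain $j$, and moreover a reference to a synchronized block. It yields a block if the hash value is $<md$. The hash value modulo $m$ (its last $\log_2 m$ bits when $m$ is a power of two) is the index $c$ of the chain of the block; its parent is the $c$-th reference. The clock of a genesis block is $0$, and that of another block is $v_s+1$ if $v_p\le v_s$ and $-1$ (invalid) otherwise, where $v_p$ and $v_s$ are the clocks of its parent and of its synchronized block. A received block is accepted once its parent and its synchronized block are accepted, provided that its parent belongs to the same chain and its clock is not $-1$. An honest participant follows the longest chain rule as above in each chain, mines on all $m$ main chains at once, and takes as synchronized block one with the largest clock among the last blocks of its $m$ main chains. The *history* of a chain over $R$ rounds lists, for each round and participant, the main chain and the tree of accepted blocks of this chain at the end of the round, each block being described by its transactions, its round and its miner (and the number of the query for the adversary). **Lemma.** Let $0\le i\le m-1$. (a) For a uniform hash value, the events "the value is $<md$" and "the value is $i$ modulo $m$" are independent and have probabilities $mp$ and $1/m$. Hence each query of $\Pi_{enu}$ yields a block of chain $\mathcal C_i$ with probability $p$, which is the probability that a query of $\Pi_{nak}$ yields a block. (b) The parent of a block is fixed by the query and the hash value: in $\Pi_{enu}$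 it is the reference that the query contains for the chain of the block, and in $\Pi_{nak}$ the parent that the query contains. (c) For each set of at most $\rho n$ corrupt participants and each $\Delta$-bounded adversary $A$ against $\Pi_{enu}$ in the $(m,\rho,\Delta,n,mp)$-environment there is a $\Delta$-bounded adversary $A'$ against $\Pi_{nak}$ in the $(\rho,\Delta,n,p)$-environment, with the same corrupt participants, such that for every $R$ the history over $R$ rounds of chain $\mathcal C_i$ under $A$ has the same distribution as the history of the single chain of $\Pi_{nak}$ under $A'$. (d) Consequently $\mathcal C_i$ has the same properties as the single chain of $\Pi_{nak}$: for each $R$, each $\varepsilon$ and each property of histories over $R$ rounds (possibly depending on the set of corrupt participants), if under every admissible choice of corrupt participants and $\Delta$-bounded adversary the single chain of $\Pi_{nak}$ violates the property with probability at most $\varepsilon$, then the same holds for $\mathcal C_i$. -/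

import Mathlib

/-! ## The ideal hash and the round based execution of a proof-of-work protocol

There are `n` participants.  A hash query is answered by a uniform element of `Fin N`
(`N = 2 ^ κ` for a `κ`-bit hash). -/

/-- The probability that the answer of the oracle to a new query lies in `s`. -/
noncomputable def hashProb {N : ℕ} [NeZero N] (s : Set (Fin N)) : ENNReal :=
  (PMF.uniformOfFintype (Fin N)).toOuterMeasure s

/-- Who makes a query: a participant that follows the protocol, or the adversary with its
`k`-th query of the round. -/
inductive Miner (n : ℕ) where
  | participant (P : Fin n)
  | adversary (k : ℕ)

/-- The identity of a query: the round in which it is made and who makes it.  It is part of the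
hashed data (time stamp and nonce), so that different queries have different inputs and their
answers are independent. -/
structure QueryId (n : ℕ) where
  round : ℕ
  miner : Miner n

/-- A proof-of-work protocol, run by `n` participants with an `N`-valued hash. -/
structure Protocol (n N : ℕ) where
  /-- blocks -/
  Block : Type
  /-- the contents of a hash query -/
  Query : Type
  /-- what the environment hands to a participant in a round (outstanding transactions) -/
  Input : Type
  /-- the main chain(s) of a participant -/
  Local : Type
  /-- the initial main chain(s) -/
  init : Local
  /-- the genesis blocks -/
  genesis : Set Block
  /-- the blocks whose hash references are contained in a query -/
  cites : Query → Set Block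
  /-- the block, if any, that results when the query gets the given answer -/
  found : QueryId n → Query → Fin N → Option Block
  /-- the update of the main chain(s), given all blocks received so far, in order of arrival -/
  follow : List Block → Local → Local
  /-- the query that a participant following the protocol makes -/
  query : Local → Input → Query
  /-- the blocks that are sent when a newly found block is broadcast: the block itself and all
  the non-genesis blocks on which its acceptance depends -/
  history : Block → Set Block

/-- An adversary, together with the environment `Z`: a randomized strategy with private state.
In each round it first decides which blocks are delivered to which participants and which inputs
they get (`plan`), then sees the blocks that participants found and broadcast in this round
(`hear`), and then makes its own queries one after the other (`ask`), seeing the full hash value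
of each answer (`learn`). -/
structure Adversary {n N : ℕ} (Pr : Protocol n N) where
  State : Type
  start : State
  plan : State → PMF (State × (Fin n → List Pr.Block) × (Fin n → Pr.Input))
  hear : State → (Fin n → Option Pr.Block) → PMF State
  ask : State → PMF (State × Option Pr.Query)
  learn : State → Fin N → PMF State

/-- A global state of the execution. -/
structure Config {n N : ℕ} (Pr : Protocol n N) (S : Type) where
  /-- number of completed rounds -/
  round : ℕ
  /-- the private state of the adversary -/
  adv : S
  /-- all blocks that were found so far -/
  blocks : List (QueryId n × Pr.Block)
  /-- the blocks that each participant has received, in order of arrival -/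
  inbox : Fin n → List Pr.Block
  /-- the main chain(s) of each participant -/
  loc : Fin n → Pr.Local
  /-- for each completed round, in order, the received blocks and main chain(s) of each
  participant at the end of the round -/
  log : List (Fin n → List Pr.Block × Pr.Local)

namespace Adversary

variable {n N : ℕ} {Pr : Protocol n N} (A : Adversary Pr)

/-- The state before the first round. -/
def initial : Config Pr A.State where
  round := 0
  adv := A.start
  blocks := []
  inbox := fun _ => []
  loc := fun _ => Pr.init
  log := []

open Classical in
/-- Delivery: an honest participant receives the blocks the adversary sends to it; only existing
blocks have a valid proof of work, everything else is discarded.  Then it updates its main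
chain(s). -/
noncomputable def receive (corrupt : Finset (Fin n)) (s : Config Pr A.State)
    (a : A.State) (send : Fin n → List Pr.Block) : Config Pr A.State :=
  let inbox := fun P => if P ∈ corrupt then s.inbox P else
    s.inbox P ++ (send P).filter (fun b => b ∈ s.blocks.map Prod.snd)
  { s with
    adv := a
    inbox := inbox
    loc := fun P => if P ∈ corrupt then s.loc P else Pr.follow (inbox P) (s.loc P) }

/-- The blocks found by the honest participants in a round when they query with inputs `inp` and
the answers are `h`: each makes one query per round. -/
def won (corrupt : Finset (Fin n)) (s : Config Pr A.State) (inp : Fin n → Pr.Input)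
    (h : Fin n → Fin N) (P : Fin n) : Option Pr.Block :=
  if P ∈ corrupt then none
  else Pr.found ⟨s.round, .participant P⟩ (Pr.query (s.loc P) (inp P)) (h P)

/-- Every honest participant that found a block appends it to its own view, and the block is
recorded as existing. -/
def publish (corrupt : Finset (Fin n)) (s : Config Pr A.State)
    (w : Fin n → Option Pr.Block) (a : A.State) : Config Pr A.State :=
  let inbox := fun P => s.inbox P ++ (w P).toList
  { s with
    adv := a
    blocks := s.blocks ++ (List.finRange n).flatMap
      (fun P => (w P).toList.map fun b => (⟨s.round, .participant P⟩, b))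
    inbox := inbox
    loc := fun P => if P ∈ corrupt then s.loc P else Pr.follow (inbox P) (s.loc P) }

open Classical in
/-- The `k`-th query of the adversary in a round (it may decline to make it).  A hash value that
was never returned by the oracle cannot be referenced: a query that cites a block which does not
exist yet does not lead to a block. -/
noncomputable def attack [NeZero N] (s : Config Pr A.State) (k : ℕ) : PMF (Config Pr A.State) :=
  (A.ask s.adv).bind fun x =>
    match x.2 with
    | none => PMF.pure { s with adv := x.1 }
    | some y =>
      (PMF.uniformOfFintype (Fin N)).bind fun h =>
        (A.learn x.1 h).bind fun a =>
          PMF.pure { s with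
            adv := a
            blocks :=
              if ∀ b ∈ Pr.cites y, b ∈ Pr.genesis ∨ b ∈ s.blocks.map Prod.snd then
                s.blocks ++ (Pr.found ⟨s.round, .adversary k⟩ y h).toList.map
                  (fun b => (⟨s.round, .adversary k⟩, b))
              else s.blocks }

/-- The first `q` queries of the adversary in a round. -/
noncomputable def attacks [NeZero N] (s : Config Pr A.State) : ℕ → PMF (Config Pr A.State)
  | 0 => PMF.pure s
  | k + 1 => (attacks s k).bind fun t => A.attack t k

/-- The end of a round. -/
def close (s : Config Pr A.State) : Config Pr A.State :=
  { s with
    round := s.round + 1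
    log := s.log ++ [fun P => (s.inbox P, s.loc P)] }

/-- One round: delivery, one query by each honest participant, `q` queries by the adversary. -/
noncomputable def step [NeZero N] (corrupt : Finset (Fin n)) (q : ℕ) (s : Config Pr A.State) :
    PMF (Config Pr A.State) :=
  (A.plan s.adv).bind fun x =>
    let s₁ := A.receive corrupt s x.1 x.2.1
    (PMF.uniformOfFintype (Fin n → Fin N)).bind fun h =>
      let w := A.won corrupt s₁ x.2.2 h
      (A.hear s₁.adv w).bind fun a =>
        (A.attacks (A.publish corrupt s₁ w a) q).map A.close

/-- The law of the execution after `R` rounds. -/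
noncomputable def exec [NeZero N] (corrupt : Finset (Fin n)) (q : ℕ) :
    ℕ → PMF (Config Pr A.State)
  | 0 => PMF.pure A.initial
  | R + 1 => (exec corrupt q R).bind (A.step corrupt q)

/-- The adversary respects the delay bound `Δ`: whenever an honest participant finds a block in
round `t`, the block and all that is sent along with it has been received by each honest
participant in round `t + Δ` at the latest.  (Rounds are numbered from `0`, so `t + Δ < s.round`
says that round `t + Δ` is over.) -/
def DelayBounded [NeZero N] (corrupt : Finset (Fin n)) (q Δ : ℕ) : Prop :=
  ∀ R : ℕ, ∀ s ∈ (A.exec corrupt q R).support,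
    ∀ (t : ℕ) (P : Fin n) (b : Pr.Block), (⟨t, .participant P⟩, b) ∈ s.blocks →
      t + Δ < s.round → ∀ Q ∉ corrupt, ∀ c ∈ Pr.history b, c ∈ s.inbox Q

end Adversary

/-- The longest chain rule: keep the current chain unless there is a longer one; the chain that
arrived first wins a tie. -/
def longest {B : Type} (height : B → ℕ) (candidates : List B) (current : B) : B :=
  candidates.foldl (fun best b => if height best < height b then b else best) current

/-- What a block contributes to its chain: its transactions, the round of its creation, and who
mined it.  The identity of the query determines the block. -/
structure Entry (n : ℕ) (Tx : Type) where
  id : QueryId n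
  tx : Tx

/-- What a participant sees of one chain: its main chain, and the tree of all the blocks it has
accepted; a block is given by the sequence of blocks from the genesis block (excluded) up to it. -/
@[ext] structure NodeView (n : ℕ) (Tx : Type) where
  main : List (Entry n Tx)
  tree : Set (List (Entry n Tx))

/-- The history of one chain in an execution: for every completed round, what each participant
sees of the chain at the end of the round (a corrupt participant, as nothing is received by it,
is listed with its initial view). -/
abbrev ChainTrace (n : ℕ) (Tx : Type) := List (Fin n → NodeView n Tx)

/-! ## Nakamoto consensus -/

/-- A block of Nakamoto consensus. -/
inductive NakBlock (n N : ℕ) (Tx : Type) where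
  | genesis
  | mined (id : QueryId n) (parent : NakBlock n N Tx) (tx : Tx) (hash : Fin N)

namespace NakBlock

variable {n N : ℕ} {Tx : Type}

/-- The chain from the genesis block to this block. -/
def path : NakBlock n N Tx → List (Entry n Tx)
  | genesis => []
  | mined id parent tx _ => parent.path ++ [⟨id, tx⟩]

/-- The block that this block extends. -/
def parent? : NakBlock n N Tx → Option (NakBlock n N Tx)
  | genesis => none
  | mined _ parent _ _ => some parent

/-- The non-genesis blocks of the chain ending in this block. -/
def history : NakBlock n N Tx → Set (NakBlock n N Tx)
  | genesis => ∅
  | mined id parent tx h => insert (mined id parent tx h) parent.history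

/-- A received block is accepted when its parent is accepted; until then it is cached. -/
def Accepted (received : List (NakBlock n N Tx)) : NakBlock n N Tx → Prop
  | genesis => True
  | mined id parent tx h => mined id parent tx h ∈ received ∧ parent.Accepted received

end NakBlock

/-- The contents of a query of Nakamoto consensus: the parent and the transactions. -/
structure NakQuery (n N : ℕ) (Tx : Type) where
  parent : NakBlock n N Tx
  tx : Tx

open Classical in
/-- Nakamoto consensus.  A query yields a block when the hash value is less than `target`
(for `N = 2 ^ κ` and `target = 2 ^ (κ - l)`: when it has `l` leading zeros); participants
follow the longest chain rule. -/
noncomputable def nakamoto (n N : ℕ) (Tx : Type) (target : ℕ) : Protocol n N where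
  Block := NakBlock n N Tx
  Query := NakQuery n N Tx
  Input := Tx
  Local := NakBlock n N Tx
  init := .genesis
  genesis := {.genesis}
  cites x := {x.parent}
  found id x h := if (h : ℕ) < target then some (.mined id x.parent x.tx h) else none
  follow received tip :=
    longest (fun b => b.path.length) (received.filter (fun b => b.Accepted received)) tip
  query tip tx := ⟨tip, tx⟩
  history b := b.history

/-- The history of the single chain of Nakamoto consensus. -/
def nakTrace {n N : ℕ} {Tx S : Type} {target : ℕ}
    (s : Config (nakamoto n N Tx target) S) : ChainTrace n Tx :=
  List.map
    (fun (v : Fin n → List (NakBlock n N Tx) × NakBlock n N Tx) (P : Fin n) =>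
      { main := (v P).2.path
        tree := {l | ∃ b ∈ (v P).1, b.Accepted (v P).1 ∧ b.path = l} })
    s.log

/-! ## Eunomia -/

/-- A block of Eunomia with `m` chains: for each chain, a reference to a block and
transactions, moreover a reference to the synchronized block, and the hash value. -/
inductive EunBlock (n N m : ℕ) (Tx : Type) where
  | genesis (c : Fin m)
  | mined (id : QueryId n) (refs : Fin m → EunBlock n N m Tx) (txs : Fin m → Tx)
      (sync : EunBlock n N m Tx) (hash : Fin N)

namespace EunBlock

variable {n N m : ℕ} [NeZero m] {Tx : Type}

/-- The chain index determined by a hash value: its residue modulo `m` (for `m = 2 ^ k`: its last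
`k` bits). -/
def index (m : ℕ) [NeZero m] {N : ℕ} (h : Fin N) : Fin m := Fin.ofNat m (h : ℕ)

/-- The chain to which a block belongs. -/
def chain : EunBlock n N m Tx → Fin m
  | genesis c => c
  | mined _ _ _ _ h => index m h

/-- The block that this block extends: the reference in the position of its own chain. -/
def parent? : EunBlock n N m Tx → Option (EunBlock n N m Tx)
  | genesis _ => none
  | mined _ refs _ _ h => some (refs (index m h))

/-- The chain from the genesis block to this block, along parents. -/
def path : EunBlock n N m Tx → List (Entry n Tx)
  | genesis _ => []
  | mined id refs txs _ h => (refs (index m h)).path ++ [⟨id, txs (index m h)⟩]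

/-- The virtual logical clock; the value `-1` marks a block that cites a synchronized block with
a smaller clock than its parent. -/
def clock : EunBlock n N m Tx → ℤ
  | genesis _ => 0
  | mined _ refs _ sync h =>
    if sync.clock < (refs (index m h)).clock then -1 else sync.clock + 1

/-- The non-genesis blocks reached from this block along parents and synchronized blocks. -/
def history : EunBlock n N m Tx → Set (EunBlock n N m Tx)
  | genesis _ => ∅
  | mined id refs txs sync h =>
    insert (mined id refs txs sync h) ((refs (index m h)).history ∪ sync.history)

/-- A received block is accepted when its parent and its synchronized block are accepted (until
then it is cached), its parent belongs to the same chain, and its clock is valid. -/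
def Accepted (received : List (EunBlock n N m Tx)) : EunBlock n N m Tx → Prop
  | genesis _ => True
  | mined id refs txs sync h =>
    mined id refs txs sync h ∈ received ∧
      (refs (index m h)).Accepted received ∧ sync.Accepted received ∧
      (refs (index m h)).chain = index m h ∧ 0 ≤ (mined id refs txs sync h).clock

/-- The block with the largest virtual clock among the last blocks of the main chains. -/
noncomputable def latest (tips : Fin m → EunBlock n N m Tx) : EunBlock n N m Tx :=
  tips (((List.finRange m).argmax fun c => (tips c).clock).getD 0)

end EunBlock

/-- The contents of a query of Eunomia: references and transactions for all chains, and the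
reference to the synchronized block. -/
structure EunQuery (n N m : ℕ) (Tx : Type) where
  refs : Fin m → EunBlock n N m Tx
  txs : Fin m → Tx
  sync : EunBlock n N m Tx

open Classical in
/-- Eunomia with `m` chains.  A query yields a block when the hash value is less than `target`,
and the hash value modulo `m` tells the chain of the block.  Participants follow the longest chain
rule in each of the chains, mine on all main chains at once, and cite the block with the largest
clock as the synchronized block. -/
noncomputable def eunomia (n N m : ℕ) [NeZero m] (Tx : Type) (target : ℕ) : Protocol n N where
  Block := EunBlock n N m Tx
  Query := EunQuery n N m Tx
  Input := Fin m → Tx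
  Local := Fin m → EunBlock n N m Tx
  init := .genesis
  genesis := Set.range .genesis
  cites x := insert x.sync (Set.range x.refs)
  found id x h := if (h : ℕ) < target then some (.mined id x.refs x.txs x.sync h) else none
  follow received tips c :=
    longest (fun b => b.path.length)
      (received.filter (fun b => b.Accepted received ∧ b.chain = c)) (tips c)
  query tips txs := ⟨tips, txs, EunBlock.latest tips⟩
  history b := b.history

/-- The history of chain `i` of Eunomia. -/
def eunTrace {n N m : ℕ} [NeZero m] {Tx S : Type} {target : ℕ} (i : Fin m)
    (s : Config (eunomia n N m Tx target) S) : ChainTrace n Tx :=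
  List.map
    (fun (v : Fin n → List (EunBlock n N m Tx) × (Fin m → EunBlock n N m Tx)) (P : Fin n) =>
      { main := ((v P).2 i).path
        tree := {l | ∃ b ∈ (v P).1, b.Accepted (v P).1 ∧ b.chain = i ∧ b.path = l} })
    s.log

/-- In the environment given by `ρ` and `Δ` (at most `ρ n` corrupt participants, `ρ n` queries of
the adversary per round, delay at most `Δ`), the history of a chain over `R` rounds, as read off by
`trace`, violates the property `good` with probability at most `ε`.  The property may refer to the
set of corrupt participants. -/
def Guarantees {n N : ℕ} [NeZero N] (Pr : Protocol n N) {T : Type}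
    (trace : ∀ {S : Type}, Config Pr S → T) (ρ : ℝ) (Δ R : ℕ)
    (good : Finset (Fin n) → Set T) (ε : ENNReal) : Prop :=
  ∀ corrupt : Finset (Fin n), (corrupt.card : ℝ) ≤ ρ * n →
    ∀ A : Adversary Pr, A.DelayBounded corrupt ⌊ρ * n⌋₊ Δ →
      (A.exec corrupt ⌊ρ * n⌋₊ R).toOuterMeasure {s | trace s ∉ good corrupt} ≤ ε

/-! ## Counting hash values -/

/-! Exactly `d` of the hash values below `m * d` are congruent to `i` modulo `m`, as many as there
are values below `d`. This gives the probabilities, and a permutation `e` of the hash values under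
which "success in Nakamoto consensus" becomes "success in chain `i`" (`exists_equiv_hash`). For the
reduction, the adversary against Nakamoto consensus runs a whole execution of Eunomia in its head,
and only chain `i` is played for real. A query of the simulated adversary is passed on exactly when
it could yield a valid block of chain `i`, and the answer is translated by `e`; all other answers
are sampled privately. Honest hash values are not visible to the reduction; it sees only the blocks
found, and samples the values uniformly given this observation, which reproduces the uniform law
(`coupled_uniformFibre`). Acceptance in Eunomia also depends on synchronized blocks of other chains.
The reduction absorbs this by delivering a block of chain `i` only once its counterpart is accepted.
As ancestors of accepted blocks are accepted, nothing is ever cached on the Nakamoto side, and the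
longest chain rule sees the same candidates in the same order (`NodeSim.receive`,
`NodeSim.publish`). The two executions are coupled round by round so that the Nakamoto state is
always the projection of the Eunomia state to chain `i` (`Matching.step`). Equality of the laws of
the histories and the delay bound both follow from this coupling, and the inheritance of properties
follows from equality of the laws. -/

theorem hashProb_setOf {N : ℕ} [NeZero N] (P : Fin N → Prop) [DecidablePred P] {k : ℕ} {r : ℝ}
    (hk : (Finset.univ.filter P).card = k) (hr : r = (k : ℝ) / N) :
    hashProb {h : Fin N | P h} = ENNReal.ofReal r := by
  have hN : (0 : ℝ) < N := by exact_mod_cast Nat.pos_of_ne_zero (NeZero.ne N)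
  classical
  unfold hashProb
  rw [PMF.toOuterMeasure_uniformOfFintype_apply, hr, ENNReal.ofReal_div_of_pos hN,
    ENNReal.ofReal_natCast, ENNReal.ofReal_natCast, Fintype.card_fin, ← hk]
  congr 2
  exact Fintype.card_of_subtype _ (by simp)

/-- The values in question are `m * j + i` with `j < k`, one in each run of `m` consecutive numbers.
The cases `m = 1` and `k = N / m` give the two marginal counts. -/
theorem card_lt_and_index_eq {N m : ℕ} [NeZero m] (i : Fin m) {k : ℕ} (hk : m * k ≤ N) :
    (Finset.univ.filter fun h : Fin N => (h : ℕ) < m * k ∧ EunBlock.index m h = i).card = k := by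
  have hm : 0 < m := Nat.pos_of_ne_zero (NeZero.ne m)
  have hlt : ∀ j : Fin k, m * (j : ℕ) + i < m * k := fun j =>
    calc m * (j : ℕ) + i < m * j + m := by have := i.2; omega
      _ = m * (j + 1) := by ring
      _ ≤ m * k := Nat.mul_le_mul_left _ j.2
  let f : Fin k → Fin N := fun j => ⟨m * j + i, (hlt j).trans_le hk⟩
  have hf : Function.Injective f := by
    intro a b h
    have h' : m * (a : ℕ) + i = m * b + i := congrArg Fin.val h
    exact Fin.ext (Nat.eq_of_mul_eq_mul_left hm (Nat.add_right_cancel h'))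
  have himg : (Finset.univ.filter fun h : Fin N =>
      (h : ℕ) < m * k ∧ EunBlock.index m h = i) = Finset.univ.image f := by
    ext h
    simp only [Finset.mem_filter, Finset.mem_univ, true_and, Finset.mem_image]
    constructor
    · rintro ⟨h1, h2⟩
      have h3 : (h : ℕ) % m = i := by simpa [EunBlock.index] using congrArg Fin.val h2
      refine ⟨⟨h / m, Nat.div_lt_of_lt_mul h1⟩, Fin.ext ?_⟩
      show m * ((h : ℕ) / m) + i = h
      rw [← h3, Nat.div_add_mod]
    · rintro ⟨j, rfl⟩
      refine ⟨hlt j, Fin.ext ?_⟩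
      show (m * (j : ℕ) + i) % m = i
      rw [Nat.mul_add_mod, Nat.mod_eq_of_lt i.2]
  rw [himg, Finset.card_image_of_injective _ hf, Finset.card_univ, Fintype.card_fin]

theorem card_val_lt {N k : ℕ} (hk : k ≤ N) :
    (Finset.univ.filter fun h : Fin N => (h : ℕ) < k).card = k := by
  have := card_lt_and_index_eq (N := N) (m := 1) 0 (k := k) (by simpa using hk)
  simpa [Subsingleton.elim _ (0 : Fin 1)] using this

theorem card_index_eq {N m : ℕ} [NeZero m] (hmN : m ∣ N) (i : Fin m) :
    (Finset.univ.filter fun h : Fin N => EunBlock.index m h = i).card = N / m := by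
  have := card_lt_and_index_eq (N := N) i (k := N / m) (Nat.mul_div_cancel' hmN).le
  simpa [Nat.mul_div_cancel' hmN] using this

/-- Both sets have `d` elements, so a bijection between them extends to a permutation of all hash
values. Being a permutation, it preserves the uniform law. -/
theorem exists_equiv_hash {N m d : ℕ} [NeZero m] (i : Fin m) (hd : m * d ≤ N) :
    ∃ e : Fin N ≃ Fin N, ∀ h : Fin N,
      (((e h : Fin N) : ℕ) < m * d ∧ EunBlock.index m (e h) = i) ↔ (h : ℕ) < d := by
  have hm : 0 < m := Nat.pos_of_ne_zero (NeZero.ne m)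
  have hdN : d ≤ N := (Nat.le_mul_of_pos_left d hm).trans hd
  have hcard : Fintype.card {h : Fin N // (h : ℕ) < d} =
      Fintype.card {h : Fin N // (h : ℕ) < m * d ∧ EunBlock.index m h = i} := by
    rw [Fintype.card_subtype, Fintype.card_subtype, card_val_lt hdN, card_lt_and_index_eq i hd]
  let e₀ := Fintype.equivOfCardEq hcard
  refine ⟨e₀.extendSubtype, fun h => ⟨fun hh => ?_, fun hh => e₀.extendSubtype_mem h hh⟩⟩
  by_contra hn
  exact e₀.extendSubtype_not_mem h hn hh

/-! ## Couplings of discrete laws -/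

namespace PMF

variable {α β γ δ : Type}

theorem map_fun_id (μ : PMF α) : μ.map (fun a => a) = μ := PMF.map_id μ

/-- There is a coupling of `μ` and `ν` whose support lies in the relation `R`. -/
def Coupled (R : α → β → Prop) (μ : PMF α) (ν : PMF β) : Prop :=
  ∃ κ : PMF (α × β), κ.map Prod.fst = μ ∧ κ.map Prod.snd = ν ∧ ∀ x ∈ κ.support, R x.1 x.2

theorem Coupled.pure {R : α → β → Prop} {a : α} {b : β} (h : R a b) :
    Coupled R (PMF.pure a) (PMF.pure b) :=
  ⟨PMF.pure (a, b), PMF.pure_map _ _, PMF.pure_map _ _, by simpa using h⟩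

theorem Coupled.bind {R : α → β → Prop} {S : γ → δ → Prop} {μ : PMF α} {ν : PMF β}
    {f : α → PMF γ} {g : β → PMF δ} (h : Coupled R μ ν)
    (hfg : ∀ a b, R a b → Coupled S (f a) (g b)) : Coupled S (μ.bind f) (ν.bind g) := by
  classical
  obtain ⟨κ, rfl, rfl, hκ⟩ := h
  -- Off the relation the choice of `l` is immaterial, since `κ` puts no mass there; an independent
  -- pair serves.
  have : ∀ x : α × β, ∃ l : PMF (γ × δ), R x.1 x.2 →
      l.map Prod.fst = f x.1 ∧ l.map Prod.snd = g x.2 ∧ ∀ y ∈ l.support, S y.1 y.2 := by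
    intro x
    by_cases hx : R x.1 x.2
    · obtain ⟨l, hl⟩ := hfg _ _ hx
      exact ⟨l, fun _ => hl⟩
    · exact ⟨(f x.1).bind fun c => (g x.2).map fun d => (c, d), fun h => absurd h hx⟩
  choose l hl using this
  have hcongr : ∀ {ε : Type} (F G : α × β → PMF ε), (∀ x ∈ κ.support, F x = G x) →
      κ.bind F = κ.bind G := by
    intro ε F G hFG
    ext y
    simp only [PMF.bind_apply]
    refine tsum_congr fun x => ?_
    by_cases hx : κ x = 0
    · simp [hx]
    · rw [hFG x hx]
  refine ⟨κ.bind l, ?_, ?_, ?_⟩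
  · rw [PMF.map_bind, PMF.bind_map]
    exact hcongr _ _ fun x hx => (hl x (hκ x hx)).1
  · rw [PMF.map_bind, PMF.bind_map]
    exact hcongr _ _ fun x hx => (hl x (hκ x hx)).2.1
  · intro y hy
    obtain ⟨x, hx, hy⟩ := (PMF.mem_support_bind_iff _ _ _).1 hy
    exact (hl x (hκ x hx)).2.2 y hy

theorem Coupled.refl (μ : PMF α) : Coupled (· = ·) μ μ :=
  ⟨μ.map fun a => (a, a), by simp [PMF.map_comp, Function.comp_def, PMF.map_fun_id],
    by simp [PMF.map_comp, Function.comp_def, PMF.map_fun_id], by simp⟩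

theorem Coupled.map {R : α → β → Prop} {S : γ → δ → Prop} {μ : PMF α} {ν : PMF β}
    {f : α → γ} {g : β → δ} (h : Coupled R μ ν) (hfg : ∀ a b, R a b → S (f a) (g b)) :
    Coupled S (μ.map f) (ν.map g) :=
  h.bind fun a b hab => Coupled.pure (hfg a b hab)

theorem Coupled.map_eq {R : α → β → Prop} {μ : PMF α} {ν : PMF β} {f : α → γ} {g : β → γ}
    (h : Coupled R μ ν) (hfg : ∀ a b, R a b → f a = g b) : μ.map f = ν.map g := by
  obtain ⟨κ, h1, h2, h3⟩ := h.map (S := (· = ·)) hfg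
  rw [← h1, ← h2]
  ext y
  simp only [PMF.map_apply]
  refine tsum_congr fun x => ?_
  by_cases hx : κ x = 0
  · simp [hx]
  · rw [h3 x hx]

/-- Transfers statements about all reachable states, such as the delay bound, from one execution to
the other. -/
theorem Coupled.exists_of_mem_support {R : α → β → Prop} {μ : PMF α} {ν : PMF β}
    (h : Coupled R μ ν) {b : β} (hb : b ∈ ν.support) : ∃ a ∈ μ.support, R a b := by
  obtain ⟨κ, rfl, rfl, hκ⟩ := h
  obtain ⟨x, hx, rfl⟩ := (PMF.mem_support_map_iff _ _ _).1 hb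
  exact ⟨x.1, (PMF.mem_support_map_iff _ _ _).2 ⟨x, hx, rfl⟩, hκ x hx⟩

/-- One move of the reduction may consist of several random choices. Regrouping them by
associativity aligns them with the moves of the original adversary. -/
theorem Coupled.bind_bind_right {R : α → γ → Prop} {μ : PMF α} {p : PMF β} {q : PMF δ}
    {f : δ → PMF β} {g : β → PMF γ} (hp : p = q.bind f)
    (h : Coupled R μ (q.bind fun a => (f a).bind g)) : Coupled R μ (p.bind g) := by
  rwa [hp, PMF.bind_bind]

theorem Coupled.map_bind_right {R : α → γ → Prop} {μ : PMF α} {p : PMF β} {q : PMF δ}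
    {f : δ → β} {g : β → PMF γ} (hp : p = q.map f)
    (h : Coupled R μ (q.bind fun a => g (f a))) : Coupled R μ (p.bind g) := by
  rw [hp, PMF.bind_map]
  exact h

theorem Coupled.pure_bind_right {R : α → γ → Prop} {μ : PMF α} {p : PMF β} {b : β}
    {g : β → PMF γ} (hp : p = PMF.pure b) (h : Coupled R μ (g b)) : Coupled R μ (p.bind g) := by
  rwa [hp, PMF.pure_bind]

open Classical in
/-- A uniform element of the fibre of `g` over `o`. -/
noncomputable def uniformFibre {X O : Type} [Fintype X] [Nonempty X] (g : X → O) (o : O) : PMF X :=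
  if h : (Finset.univ.filter fun x => g x = o).Nonempty then
    PMF.uniformOfFinset (Finset.univ.filter fun x => g x = o) h
  -- Empty fibres do not arise in the couplings below; this value only makes the function total.
  else PMF.uniformOfFintype X

/-- Since `g ∘ e = f`, the observations `f x` and `g y` have the same law for uniform `x` and `y`.
Drawing the observation first and then a uniform point of its fibre under `g` therefore gives a
uniform `y`. -/
theorem coupled_uniformFibre {X O : Type} [Fintype X] [Nonempty X] (e : X ≃ X) (f g : X → O)
    (hfg : ∀ x, g (e x) = f x) :
    Coupled (fun (y : X) (z : X × X) => z.2 = y ∧ g y = f z.1) (PMF.uniformOfFintype X)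
      ((PMF.uniformOfFintype X).bind fun x => (uniformFibre g (f x)).map fun y => (x, y)) := by
  classical
  have hne : ∀ x, (Finset.univ.filter fun y => g y = f x).Nonempty := fun x =>
    ⟨e x, by simp [hfg]⟩
  refine ⟨(PMF.uniformOfFintype X).bind fun x =>
    (uniformFibre g (f x)).map fun y => (y, (x, y)), ?_, ?_, ?_⟩
  · simp only [PMF.map_bind, PMF.map_comp, Function.comp_def, PMF.map_fun_id]
    ext y
    simp only [PMF.bind_apply, PMF.uniformOfFintype_apply]
    rw [ENNReal.tsum_mul_left]
    suffices h : ∑' x, uniformFibre g (f x) y = 1 by rw [h, mul_one]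
    have hval : ∀ x, uniformFibre g (f x) y =
        if f x = g y then ((Finset.univ.filter fun z => g z = g y).card : ENNReal)⁻¹ else 0 := by
      intro x
      rw [uniformFibre, dif_pos (hne x)]
      by_cases hx : f x = g y
      · rw [if_pos hx, PMF.uniformOfFinset_apply_of_mem _ (by simp [hx]), hx]
      · rw [if_neg hx, PMF.uniformOfFinset_apply_of_notMem _ (by simpa using fun h => hx h.symm)]
    -- `e` maps the fibre of `f` bijectively onto the fibre of `g`, so the weights sum to `1`.
    have hcard : (Finset.univ.filter fun x => f x = g y).card =
        (Finset.univ.filter fun z => g z = g y).card :=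
      Finset.card_bij' (fun x _ => e x) (fun z _ => e.symm z) (by simp [hfg])
        (by simp [← hfg]) (by simp) (by simp)
    simp only [hval]
    rw [tsum_fintype, ← Finset.sum_filter, Finset.sum_const, hcard, nsmul_eq_mul]
    exact ENNReal.mul_inv_cancel (by
      have : y ∈ (Finset.univ.filter fun z => g z = g y) := by simp
      exact_mod_cast (Finset.card_pos.2 ⟨y, this⟩).ne') (ENNReal.natCast_ne_top _)
  · simp only [PMF.map_bind, PMF.map_comp, Function.comp_def]
  · intro z hz
    obtain ⟨x, -, hz⟩ := (PMF.mem_support_bind_iff _ _ _).1 hz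
    obtain ⟨y, hy, rfl⟩ := (PMF.mem_support_map_iff _ _ _).1 hz
    refine ⟨rfl, ?_⟩
    rw [uniformFibre, dif_pos (hne x), PMF.mem_support_uniformOfFinset_iff] at hy
    simpa using hy

/-- Here `x` stands for the real hash values, of which only `f x` is observed, and `y` for the
simulated ones. The continuations need to match only when the observations agree. -/
theorem coupled_bind_uniformFibre {X O : Type} [Fintype X] [Nonempty X] (e : X ≃ X) (f g : X → O)
    (hfg : ∀ x, g (e x) = f x) {S : γ → δ → Prop} {F : X → PMF γ} {L : X → PMF δ}
    (K : X → X → PMF δ) (hL : ∀ x, L x = (uniformFibre g (f x)).bind (K x))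
    (h : ∀ x y, g y = f x → Coupled S (F y) (K x y)) :
    Coupled S ((PMF.uniformOfFintype X).bind F) ((PMF.uniformOfFintype X).bind L) := by
  have := (coupled_uniformFibre e f g hfg).bind (S := S) (f := F) (g := fun z => K z.1 z.2) (by
    rintro _ z ⟨rfl, hz⟩
    exact h _ _ hz)
  rw [PMF.bind_bind] at this
  simp only [PMF.bind_map, Function.comp_def] at this
  rwa [funext hL]

theorem coupled_uniformOfFintype {X : Type} [Fintype X] [Nonempty X] (e : X ≃ X) :
    Coupled (fun y x => y = e x) (PMF.uniformOfFintype X) (PMF.uniformOfFintype X) := by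
  refine ⟨(PMF.uniformOfFintype X).map fun x => (e x, x), ?_, ?_, by simp⟩
  · simp only [PMF.map_comp, Function.comp_def]
    ext y
    rw [PMF.map_apply, tsum_eq_single (e.symm y)]
    · simp
    · intro x hx
      rw [if_neg]
      rintro rfl
      simp at hx
  · simp [PMF.map_comp, Function.comp_def, PMF.map_fun_id]

end PMF

/-! ## The longest chain rule -/

theorem longest_append {B : Type} (height : B → ℕ) (l₁ l₂ : List B) (t : B) :
    longest height (l₁ ++ l₂) t = longest height l₂ (longest height l₁ t) :=
  List.foldl_append

theorem longest_eq_self {B : Type} (height : B → ℕ) (l : List B) (t : B)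
    (h : ∀ b ∈ l, height b ≤ height t) : longest height l t = t := by
  induction l with
  | nil => rfl
  | cons a l ih =>
    rw [longest, List.foldl_cons, if_neg (not_lt.2 (h a (by simp)))]
    exact ih fun b hb => h b (by simp [hb])

theorem longest_mem {B : Type} (height : B → ℕ) (l : List B) (t : B) :
    longest height l t = t ∨ longest height l t ∈ l := by
  induction l generalizing t with
  | nil => exact Or.inl rfl
  | cons a l ih =>
    have hstep : longest height (a :: l) t =
        longest height l (if height t < height a then a else t) := rfl
    rw [hstep]
    split
    · rcases ih a with h | h <;> simp [h]
    · rcases ih t with h | h <;> simp [h]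

theorem height_le_longest {B : Type} (height : B → ℕ) (l : List B) (t : B) :
    height t ≤ height (longest height l t) ∧ ∀ b ∈ l, height b ≤ height (longest height l t) := by
  induction l generalizing t with
  | nil => exact ⟨le_rfl, by simp⟩
  | cons a l ih =>
    have hstep : longest height (a :: l) t =
        longest height l (if height t < height a then a else t) := rfl
    have := ih (if height t < height a then a else t)
    rw [hstep]
    refine ⟨le_trans ?_ this.1, ?_⟩
    · split <;> omega
    · intro b hb
      rcases List.mem_cons.1 hb with rfl | hb
      · refine le_trans ?_ this.1
        split <;> omega
      · exact this.2 b hb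

theorem longest_map {B C : Type} (hB : B → ℕ) (hC : C → ℕ) (f : B → C) (l : List B) (t : B)
    (hl : ∀ b ∈ l, hC (f b) = hB b) (ht : hC (f t) = hB t) :
    longest hC (l.map f) (f t) = f (longest hB l t) := by
  induction l generalizing t with
  | nil => rfl
  | cons a l ih =>
    have ha := hl a (by simp)
    have hl' : ∀ b ∈ l, hC (f b) = hB b := fun b hb => hl b (by simp [hb])
    simp only [longest, List.map_cons, List.foldl_cons] at ih ⊢
    rw [ha, ht]
    split
    · exact ih a hl' ha
    · exact ih t hl' ht

/-! ## Blocks of Nakamoto consensus -/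

namespace NakBlock

variable {n N : ℕ} {Tx : Type}

theorem accepted_iff (r : List (NakBlock n N Tx)) (b : NakBlock n N Tx) :
    b.Accepted r ↔ ∀ c ∈ b.history, c ∈ r := by
  induction b with
  | genesis => simp [Accepted, history]
  | mined id parent tx h ih => simp [Accepted, history, ih]

end NakBlock

/-! ## Blocks of Eunomia -/

namespace EunBlock

variable {n N m : ℕ} [NeZero m] {Tx : Type}

/-- A block all of whose ancestors lie in their proper chains and have a valid clock. -/
def Valid : EunBlock n N m Tx → Prop
  | genesis _ => True
  | mined id refs txs sync h =>
    (refs (index m h)).Valid ∧ sync.Valid ∧ (refs (index m h)).chain = index m h ∧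
      0 ≤ (mined id refs txs sync h).clock

/-- Separates what is intrinsic to the block from what depends on the received blocks. The latter
part is monotone in `r`. -/
theorem accepted_iff (r : List (EunBlock n N m Tx)) (b : EunBlock n N m Tx) :
    b.Accepted r ↔ b.Valid ∧ ∀ c ∈ b.history, c ∈ r := by
  induction b with
  | genesis => simp [Accepted, history, Valid]
  | mined id refs txs sync h ih1 ih2 =>
    simp only [Accepted, history, Valid, ih1, ih2, Set.mem_insert_iff, Set.mem_union]
    constructor
    · rintro ⟨h1, ⟨h2, h3⟩, ⟨h4, h5⟩, h6, h7⟩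
      refine ⟨⟨h2, h4, h6, h7⟩, ?_⟩
      rintro c (rfl | hc | hc)
      exacts [h1, h3 c hc, h5 c hc]
    · rintro ⟨⟨h2, h4, h6, h7⟩, h⟩
      exact ⟨h _ (Or.inl rfl), ⟨h2, fun c hc => h c (Or.inr (Or.inl hc))⟩,
        ⟨h4, fun c hc => h c (Or.inr (Or.inr hc))⟩, h6, h7⟩

theorem Accepted.mono {r r' : List (EunBlock n N m Tx)} {b : EunBlock n N m Tx}
    (h : b.Accepted r) (hr : ∀ c ∈ r, c ∈ r') : b.Accepted r' := by
  rw [accepted_iff] at h ⊢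
  exact ⟨h.1, fun c hc => hr c (h.2 c hc)⟩

theorem Valid.clock_nonneg {b : EunBlock n N m Tx} (h : b.Valid) : 0 ≤ b.clock := by
  cases b with
  | genesis => simp [clock]
  | mined id refs txs sync h => exact h.2.2.2

/-- A valid synchronized block has a nonnegative clock, so the new clock is negative only through
the mark `-1`. -/
theorem valid_mined_iff (id : QueryId n) (refs : Fin m → EunBlock n N m Tx) (txs : Fin m → Tx)
    (sync : EunBlock n N m Tx) (h : Fin N) :
    (mined id refs txs sync h).Valid ↔ (refs (index m h)).Valid ∧ sync.Valid ∧
      (refs (index m h)).chain = index m h ∧ (refs (index m h)).clock ≤ sync.clock := by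
  refine ⟨fun hv => ⟨hv.1, hv.2.1, hv.2.2.1, ?_⟩, fun hv => ⟨hv.1, hv.2.1, hv.2.2.1, ?_⟩⟩
  · have := hv.2.2.2
    simp only [clock] at this
    split_ifs at this
    · simp at this
    · omega
  · have := hv.2.1.clock_nonneg
    simp only [clock]
    rw [if_neg (not_lt.2 hv.2.2.2)]
    omega

theorem self_mem_history (id : QueryId n) (refs : Fin m → EunBlock n N m Tx) (txs : Fin m → Tx)
    (sync : EunBlock n N m Tx) (h : Fin N) :
    mined id refs txs sync h ∈ (mined id refs txs sync h).history :=
  Set.mem_insert _ _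

theorem exists_latest_eq (tips : Fin m → EunBlock n N m Tx) : ∃ c, latest tips = tips c :=
  ⟨_, rfl⟩

theorem clock_le_latest (tips : Fin m → EunBlock n N m Tx) (c : Fin m) :
    (tips c).clock ≤ (latest tips).clock := by
  -- There is at least one chain, so the default `0` in `latest` is not used.
  have hne : (List.finRange m).argmax (fun c => (tips c).clock) ≠ none := by
    rw [Ne, List.argmax_eq_none]
    exact List.ne_nil_of_mem (List.mem_finRange c)
  obtain ⟨a, ha⟩ := Option.ne_none_iff_exists'.1 hne
  rw [latest, ha, Option.getD_some]
  exact List.le_of_mem_argmax (f := fun c => (tips c).clock) (List.mem_finRange c) ha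

/-! ### Blocks of one chain as blocks of Nakamoto consensus -/

variable (e : Fin N ≃ Fin N) (i : Fin m)

/-- The block of Nakamoto consensus that corresponds to a block of chain `i`, where `e` translates
the hash values. -/
def toNak : EunBlock n N m Tx → NakBlock n N Tx
  | genesis _ => .genesis
  -- In chain `i` the parent is `refs i`. The values on other blocks are irrelevant, as `proj`
  -- discards them.
  | mined id refs txs _ h => .mined id ((refs i).toNak) (txs i) (e.symm h)

open Classical in
/-- The block of Nakamoto consensus that corresponds to a valid block of chain `i`. -/
noncomputable def proj (b : EunBlock n N m Tx) : Option (NakBlock n N Tx) :=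
  if b.Valid ∧ b.chain = i then some (b.toNak e i) else none

theorem proj_eq_some_iff {b : EunBlock n N m Tx} {b' : NakBlock n N Tx} :
    b.proj e i = some b' ↔ b.Valid ∧ b.chain = i ∧ b.toNak e i = b' := by
  simp [proj, and_assoc]

theorem proj_of_valid {b : EunBlock n N m Tx} (h : b.Valid) (hc : b.chain = i) :
    b.proj e i = some (b.toNak e i) := by
  simp [proj, h, hc]

theorem path_toNak {b : EunBlock n N m Tx} (h : b.Valid) (hc : b.chain = i) :
    (b.toNak e i).path = b.path := by
  induction b with
  | genesis => rfl
  | mined id refs txs sync a ih1 ih2 =>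
    have hi : index m a = i := hc
    have hv := h.1
    have hv3 := h.2.2.1
    rw [hi] at hv hv3
    simp only [toNak, NakBlock.path, path, hi, ih1 i hv hv3]

/-- The ancestors of the projected block come from ancestors along parents in chain `i`. Inclusion
of their histories is recorded because it makes them accepted whenever `b` is. -/
theorem mem_history_toNak {b : EunBlock n N m Tx} (h : b.Valid) (hc : b.chain = i)
    {c' : NakBlock n N Tx} (hc' : c' ∈ (b.toNak e i).history) :
    ∃ c ∈ b.history, c.proj e i = some c' ∧ ∀ x ∈ c.history, x ∈ b.history := by
  induction b with
  | genesis => exact absurd hc' (by simp [toNak, NakBlock.history])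
  | mined id refs txs sync a ih1 ih2 =>
    have hi : index m a = i := hc
    have hv := h.1
    have hv3 := h.2.2.1
    rw [hi] at hv hv3
    simp only [toNak, NakBlock.history, Set.mem_insert_iff] at hc'
    rcases hc' with rfl | hc'
    · exact ⟨_, self_mem_history _ _ _ _ _, proj_of_valid e i h hc, fun x hx => hx⟩
    · obtain ⟨c, h1, h2, h3⟩ := ih1 i hv hv3 hc'
      have hsub : ∀ x ∈ (refs i).history, x ∈ (mined id refs txs sync a).history := by
        intro x hx
        simp only [history, hi]
        exact Or.inr (Or.inl hx)
      exact ⟨c, hsub c h1, h2, fun x hx => hsub x (h3 x hx)⟩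

theorem Accepted.toNak_history {r : List (EunBlock n N m Tx)} {b : EunBlock n N m Tx}
    (h : b.Accepted r) (hc : b.chain = i) {c' : NakBlock n N Tx}
    (hc' : c' ∈ (b.toNak e i).history) :
    ∃ c ∈ r, c.Accepted r ∧ c.proj e i = some c' := by
  have h' := (accepted_iff r b).1 h
  obtain ⟨c, h1, h2, h3⟩ := mem_history_toNak e i h'.1 hc hc'
  refine ⟨c, h'.2 c h1, (accepted_iff r c).2 ⟨((proj_eq_some_iff e i).1 h2).1, ?_⟩, h2⟩
  exact fun x hx => h'.2 x (h3 x hx)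

end EunBlock

/-! ## The view of one participant -/

section Node

variable {n N m : ℕ} [NeZero m] {Tx : Type}

/-- The main chains `tips` are longest accepted chains, given the received blocks. -/
structure Node (inbox : List (EunBlock n N m Tx)) (tips : Fin m → EunBlock n N m Tx) : Prop where
  chain : ∀ c, (tips c).chain = c
  accepted : ∀ c, (tips c).Accepted inbox
  max : ∀ c, ∀ b ∈ inbox, b.Accepted inbox → b.chain = c →
    b.path.length ≤ (tips c).path.length

/-- A participant of Nakamoto consensus has received the accepted blocks of chain `i`, and has the
same main chain. -/
structure NodeSim (e : Fin N ≃ Fin N) (i : Fin m) (inbox : List (EunBlock n N m Tx))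
    (tips : Fin m → EunBlock n N m Tx) (inbox' : List (NakBlock n N Tx))
    (tip' : NakBlock n N Tx) : Prop where
  mem_iff : ∀ b', b' ∈ inbox' ↔
    ∃ b ∈ inbox, b.Accepted inbox ∧ b.proj e i = some b'
  tip_eq : tip' = (tips i).toNak e i

variable {e : Fin N ≃ Fin N} {i : Fin m} {r : List (EunBlock n N m Tx)}
  {tips : Fin m → EunBlock n N m Tx} {r' : List (NakBlock n N Tx)} {t' : NakBlock n N Tx}
  {d D : ℕ}

theorem Node.valid (h : Node r tips) (c : Fin m) : (tips c).Valid :=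
  ((EunBlock.accepted_iff _ _).1 (h.accepted c)).1

theorem node_genesis : Node ([] : List (EunBlock n N m Tx)) EunBlock.genesis :=
  ⟨fun _ => rfl, fun _ => trivial, by simp⟩

theorem nodeSim_genesis :
    NodeSim e i ([] : List (EunBlock n N m Tx)) EunBlock.genesis [] NakBlock.genesis :=
  ⟨by simp, rfl⟩

theorem Node.follow (h : Node r tips) (x : List (EunBlock n N m Tx)) :
    Node (r ++ x) ((eunomia n N m Tx D).follow (r ++ x) tips) := by
  classical
  have key : ∀ c, (((eunomia n N m Tx D).follow (r ++ x) tips : Fin m → EunBlock n N m Tx) c).chain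
      = c ∧ (((eunomia n N m Tx D).follow (r ++ x) tips : Fin m → EunBlock n N m Tx) c).Accepted
        (r ++ x) := by
    intro c
    have hc : ((eunomia n N m Tx D).follow (r ++ x) tips : Fin m → EunBlock n N m Tx) c
        = longest (fun b => b.path.length) ((r ++ x).filter
          (fun b => b.Accepted (r ++ x) ∧ b.chain = c)) (tips c) := by
      simp only [eunomia]
    rw [hc]
    rcases longest_mem (fun b => b.path.length) ((r ++ x).filter
      (fun b => b.Accepted (r ++ x) ∧ b.chain = c)) (tips c) with hc | hc
    · rw [hc]
      exact ⟨h.chain c, (h.accepted c).mono (by simp +contextual)⟩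
    · simp only [List.mem_filter, decide_eq_true_eq] at hc
      exact ⟨hc.2.2, hc.2.1⟩
  refine ⟨fun c => (key c).1, fun c => (key c).2, fun c b hb hacc hbc => ?_⟩
  refine (height_le_longest (fun b => b.path.length) _ (tips c)).2 b ?_
  simp [List.mem_append.1 hb, hacc, hbc]

/-- The blocks delivered on the Nakamoto side are closed under ancestors, so none of them has to
wait. -/
theorem NodeSim.accepted (h : NodeSim e i r tips r' t') {b' : NakBlock n N Tx} (hb : b' ∈ r') :
    b'.Accepted r' := by
  obtain ⟨b, -, h2, h3⟩ := (h.mem_iff b').1 hb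
  obtain ⟨-, h4, rfl⟩ := (EunBlock.proj_eq_some_iff e i).1 h3
  rw [NakBlock.accepted_iff]
  intro c' hc'
  exact (h.mem_iff c').2 (h2.toNak_history e i h4 hc')

theorem NodeSim.length_le (hN : Node r tips) (h : NodeSim e i r tips r' t') {b' : NakBlock n N Tx}
    (hb : b' ∈ r') : b'.path.length ≤ t'.path.length := by
  obtain ⟨b, h1, h2, h3⟩ := (h.mem_iff b').1 hb
  obtain ⟨h4, h5, rfl⟩ := (EunBlock.proj_eq_some_iff e i).1 h3
  rw [h.tip_eq, EunBlock.path_toNak e i h4 h5, EunBlock.path_toNak e i (hN.valid i) (hN.chain i)]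
  exact hN.max i b h1 h2 h5

/-- If the new blocks of Nakamoto consensus are those new candidates of chain `i` that matter, the
longest chain rule takes the same decision. -/
theorem NodeSim.follow_eq {x : List (EunBlock n N m Tx)} {y : List (NakBlock n N Tx)}
    (hN : Node r tips) (h : NodeSim e i r tips r' t') (L₁ L₂ : List (EunBlock n N m Tx))
    (hL : ∀ [DecidablePred fun b : EunBlock n N m Tx => b.Accepted (r ++ x) ∧ b.chain = i],
      (r ++ x).filter (fun b => b.Accepted (r ++ x) ∧ b.chain = i) = L₁ ++ L₂)
    (hL₁ : ∀ b ∈ L₁, b.path.length ≤ (tips i).path.length)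
    (hy : y = L₂.map (fun b => b.toNak e i))
    (hacc : ∀ b' ∈ r' ++ y, b'.Accepted (r' ++ y)) :
    (nakamoto n N Tx d).follow (r' ++ y) t' =
      (((eunomia n N m Tx D).follow (r ++ x) tips : Fin m → EunBlock n N m Tx) i).toNak e i := by
  classical
  -- Candidates no longer than the current tip leave the fold unchanged, so only `L₂` and its image
  -- `y` matter.
  have hE : ((eunomia n N m Tx D).follow (r ++ x) tips : Fin m → EunBlock n N m Tx) i =
      longest (fun b => b.path.length) L₂ (tips i) := by
    simp only [eunomia]
    rw [hL, longest_append, longest_eq_self _ L₁ _ hL₁]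
  have hK : (nakamoto n N Tx d).follow (r' ++ y) t' =
      longest (fun b : NakBlock n N Tx => b.path.length) y t' := by
    simp only [nakamoto]
    rw [List.filter_eq_self.2 (by simpa using hacc), longest_append,
      longest_eq_self (fun b : NakBlock n N Tx => b.path.length) r' t'
        fun b hb => NodeSim.length_le hN h hb]
  have hmem : ∀ b ∈ L₂, b.Valid ∧ b.chain = i := by
    intro b hb
    have : b ∈ (r ++ x).filter (fun b => b.Accepted (r ++ x) ∧ b.chain = i) := by
      rw [hL]
      simp [hb]
    simp only [List.mem_filter, decide_eq_true_eq] at this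
    exact ⟨((EunBlock.accepted_iff _ _).1 this.2.1).1, this.2.2⟩
  rw [hE, hK, h.tip_eq, hy]
  refine longest_map _ _ _ _ _ (fun b hb => ?_) ?_
  · rw [EunBlock.path_toNak e i (hmem b hb).1 (hmem b hb).2]
  · rw [EunBlock.path_toNak e i (hN.valid i) (hN.chain i)]

open Classical in
/-- The accepted blocks of chain `i`, in the order of their arrival. -/
noncomputable def acceptedProj (e : Fin N ≃ Fin N) (i : Fin m) (r : List (EunBlock n N m Tx)) :
    List (NakBlock n N Tx) :=
  (r.filter fun b => b.Accepted r ∧ b.chain = i).map fun b => b.toNak e i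

theorem mem_acceptedProj {b' : NakBlock n N Tx} :
    b' ∈ acceptedProj e i r ↔ ∃ b ∈ r, b.Accepted r ∧ b.proj e i = some b' := by
  classical
  simp only [acceptedProj, List.mem_map, List.mem_filter, decide_eq_true_eq,
    EunBlock.proj_eq_some_iff]
  constructor
  · rintro ⟨b, ⟨h1, h2, h3⟩, h4⟩
    exact ⟨b, h1, h2, ((EunBlock.accepted_iff _ _).1 h2).1, h3, h4⟩
  · rintro ⟨b, h1, h2, -, h3, h4⟩
    exact ⟨b, ⟨h1, h2, h3⟩, h4⟩

/-- A delivery may release blocks cached earlier, and Eunomia ranks these by arrival, not by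
acceptance. Hence all accepted blocks of chain `i` are delivered again in their order of arrival.
The old part `r'` cannot beat the tip, so ties are broken in the same way. -/
theorem NodeSim.receive (hN : Node r tips) (h : NodeSim e i r tips r' t')
    (x : List (EunBlock n N m Tx)) :
    NodeSim e i (r ++ x) ((eunomia n N m Tx D).follow (r ++ x) tips)
      (r' ++ acceptedProj e i (r ++ x))
      ((nakamoto n N Tx d).follow (r' ++ acceptedProj e i (r ++ x)) t') := by
  classical
  have hmem : ∀ b', b' ∈ r' ++ acceptedProj e i (r ++ x) ↔
      ∃ b ∈ r ++ x, b.Accepted (r ++ x) ∧ b.proj e i = some b' := by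
    intro b'
    rw [List.mem_append, mem_acceptedProj, or_iff_right_of_imp]
    intro hb
    obtain ⟨b, h1, h2, h3⟩ := (h.mem_iff b').1 hb
    exact ⟨b, by simp [h1], h2.mono (by simp +contextual), h3⟩
  have hsim : NodeSim e i (r ++ x) tips (r' ++ acceptedProj e i (r ++ x)) (tips i |>.toNak e i) :=
    ⟨hmem, rfl⟩
  refine ⟨hmem, NodeSim.follow_eq hN h []
    ((r ++ x).filter fun b => b.Accepted (r ++ x) ∧ b.chain = i)
    ?_ (by simp) ?_ fun b' hb' => hsim.accepted hb'⟩
  · intro _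
    rw [List.nil_append]
    congr!
  · rw [acceptedProj]

/-- No received block depends on the new one, so no cached block is released and the new block is
the only candidate that counts. -/
theorem NodeSim.publish (hN : Node r tips) (h : NodeSim e i r tips r' t')
    (w : Option (EunBlock n N m Tx)) (hfresh : ∀ b ∈ w, ∀ c ∈ r, b ∉ c.history)
    (hacc : ∀ b ∈ w, b.Accepted (r ++ [b])) :
    NodeSim e i (r ++ w.toList) ((eunomia n N m Tx D).follow (r ++ w.toList) tips)
      (r' ++ (w.bind (EunBlock.proj e i)).toList)
      ((nakamoto n N Tx d).follow (r' ++ (w.bind (EunBlock.proj e i)).toList) t') := by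
  classical
  have hiff : ∀ c ∈ r, c.Accepted (r ++ w.toList) ↔ c.Accepted r := by
    intro c hc
    refine ⟨fun hc' => ?_, fun hc' => hc'.mono (by simp +contextual)⟩
    rw [EunBlock.accepted_iff] at hc' ⊢
    refine ⟨hc'.1, fun x hx => ?_⟩
    rcases List.mem_append.1 (hc'.2 x hx) with hx' | hx'
    · exact hx'
    · exact absurd hx (hfresh x (by simpa using hx') c hc)
  have hacc' : ∀ b ∈ w, b.Accepted (r ++ w.toList) := by
    intro b hb
    have := hacc b hb
    rw [Option.mem_def] at hb
    simpa [hb] using this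
  have hmem : ∀ b', b' ∈ r' ++ (w.bind (EunBlock.proj e i)).toList ↔
      ∃ b ∈ r ++ w.toList, b.Accepted (r ++ w.toList) ∧ b.proj e i = some b' := by
    intro b'
    rw [List.mem_append, h.mem_iff]
    constructor
    · rintro (⟨b, h1, h2, h3⟩ | hb')
      · exact ⟨b, by simp [h1], (hiff b h1).2 h2, h3⟩
      · simp only [Option.mem_toList, Option.bind_eq_some_iff] at hb'
        obtain ⟨b, h1, h2⟩ := hb'
        exact ⟨b, by simp [h1], hacc' b h1, h2⟩
    · rintro ⟨b, h1, h2, h3⟩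
      rcases List.mem_append.1 h1 with h1 | h1
      · exact Or.inl ⟨b, h1, (hiff b h1).1 h2, h3⟩
      · refine Or.inr ?_
        simp only [Option.mem_toList, Option.bind_eq_some_iff] at h1 ⊢
        exact ⟨b, h1, h3⟩
  have hsim : NodeSim e i (r ++ w.toList) tips (r' ++ (w.bind (EunBlock.proj e i)).toList)
      (tips i |>.toNak e i) := ⟨hmem, rfl⟩
  refine ⟨hmem, NodeSim.follow_eq hN h (r.filter fun b => b.Accepted (r ++ w.toList) ∧ b.chain = i)
    (w.toList.filter fun b => b.Accepted (r ++ w.toList) ∧ b.chain = i) ?_ ?_ ?_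
    fun b' hb' => hsim.accepted hb'⟩
  · intro _
    rw [List.filter_append]
    congr!
  · intro b hb
    simp only [List.mem_filter, decide_eq_true_eq] at hb
    exact hN.max i b hb.1 ((hiff b hb.1).1 hb.2.1) hb.2.2
  · cases w with
    | none => rfl
    | some b =>
      have hb := hacc' b rfl
      have hv := ((EunBlock.accepted_iff _ _).1 hb).1
      simp only [Option.toList_some] at hb
      by_cases hc : b.chain = i
      · simp [hb, hc, EunBlock.proj_of_valid e i hv hc]
      · simp [hc, EunBlock.proj]

theorem NodeSim.view_eq (hN : Node r tips) (h : NodeSim e i r tips r' t') :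
    ({ main := t'.path, tree := {l | ∃ b ∈ r', b.Accepted r' ∧ b.path = l} } : NodeView n Tx) =
      { main := (tips i).path
        tree := {l | ∃ b ∈ r, b.Accepted r ∧ b.chain = i ∧ b.path = l} } := by
  congr 1
  · rw [h.tip_eq, EunBlock.path_toNak e i (hN.valid i) (hN.chain i)]
  · ext l
    constructor
    · rintro ⟨b', h1, -, rfl⟩
      obtain ⟨b, h2, h3, h4⟩ := (h.mem_iff b').1 h1
      obtain ⟨h5, h6, rfl⟩ := (EunBlock.proj_eq_some_iff e i).1 h4
      exact ⟨b, h2, h3, h6, (EunBlock.path_toNak e i h5 h6).symm⟩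
    · rintro ⟨b, h1, h2, h3, rfl⟩
      have hv := ((EunBlock.accepted_iff _ _).1 h2).1
      have hm := (h.mem_iff _).2 ⟨b, h1, h2, EunBlock.proj_of_valid e i hv h3⟩
      exact ⟨_, hm, h.accepted hm, EunBlock.path_toNak e i hv h3⟩

end Node

/-! ## Corresponding executions -/

section Execution

variable {n N m : ℕ} [NeZero m] {Tx : Type}

/-- The references of existing blocks lead to existing blocks, which were found before round `R`. -/
structure Ledger (blocks : List (QueryId n × EunBlock n N m Tx)) (R : ℕ) : Prop where
  round_lt : ∀ b ∈ blocks.map Prod.snd, ∃ id refs txs sync h,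
    b = EunBlock.mined id refs txs sync h ∧ id.round < R
  closed : ∀ b ∈ blocks.map Prod.snd, ∀ c ∈ b.history, c ∈ blocks.map Prod.snd

theorem Ledger.append {blocks l : List (QueryId n × EunBlock n N m Tx)} {R R' : ℕ}
    (h : Ledger blocks R) (hR : R ≤ R')
    (hl : ∀ b ∈ l.map Prod.snd, (∃ id refs txs sync h,
      b = EunBlock.mined id refs txs sync h ∧ id.round < R') ∧
      ∀ c ∈ b.history, c = b ∨ c ∈ blocks.map Prod.snd) :
    Ledger (blocks ++ l) R' := by
  refine ⟨fun b hb => ?_, fun b hb c hc => ?_⟩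
  · rw [List.map_append, List.mem_append] at hb
    rcases hb with hb | hb
    · obtain ⟨id, refs, txs, sync, h', h1, h2⟩ := h.round_lt b hb
      exact ⟨id, refs, txs, sync, h', h1, h2.trans_le hR⟩
    · exact (hl b hb).1
  · rw [List.map_append, List.mem_append] at hb ⊢
    rcases hb with hb | hb
    · exact Or.inl (h.closed b hb c hc)
    · rcases (hl b hb).2 c hc with rfl | hc
      exacts [Or.inr hb, Or.inl hc]

/-- Invariants of the executions of Eunomia, where all blocks were found before round `R`. -/
structure Sound {S : Type} {D : ℕ} (s : Config (eunomia n N m Tx D) S) (R : ℕ) : Prop where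
  ledger : Ledger s.blocks R
  inbox : ∀ P, ∀ b ∈ s.inbox P, b ∈ s.blocks.map Prod.snd
  node : ∀ P, Node (s.inbox P) (s.loc P)

/-- The global state `s'` of Nakamoto consensus is what `s` looks like on chain `i`. -/
structure Simulates {S S' : Type} {d D : ℕ} (e : Fin N ≃ Fin N) (i : Fin m)
    (s : Config (eunomia n N m Tx D) S) (s' : Config (nakamoto n N Tx d) S') : Prop where
  round : s'.round = s.round
  blocks : ∀ (id : QueryId n) (b' : NakBlock n N Tx), (id, b') ∈ s'.blocks ↔
    ∃ b : EunBlock n N m Tx, (id, b) ∈ s.blocks ∧ b.proj e i = some b'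
  node : ∀ P, NodeSim e i (s.inbox P) (s.loc P) (s'.inbox P) (s'.loc P)
  trace : nakTrace s' = eunTrace i s

variable {d D : ℕ} {e : Fin N ≃ Fin N} {i : Fin m}
  {A : Adversary (eunomia n N m Tx D)} {A' : Adversary (nakamoto n N Tx d)}
  {corrupt : Finset (Fin n)} {R : ℕ}
  {s : Config (eunomia n N m Tx D) A.State} {s' : Config (nakamoto n N Tx d) A'.State}

theorem sound_initial : Sound A.initial R :=
  ⟨⟨fun _ hb => absurd hb List.not_mem_nil, fun _ hb => absurd hb List.not_mem_nil⟩,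
    fun _ _ hb => absurd hb List.not_mem_nil, fun _ => node_genesis⟩

theorem simulates_initial : Simulates e i A.initial A'.initial :=
  ⟨rfl, fun _ _ => ⟨fun hb => absurd hb List.not_mem_nil,
    fun ⟨_, hb, _⟩ => absurd hb List.not_mem_nil⟩, fun _ => nodeSim_genesis, rfl⟩

/-! ### Delivery -/

theorem Sound.receive (h : Sound s R) (a : A.State) (send : Fin n → List (EunBlock n N m Tx)) :
    Sound (A.receive corrupt s a send) R := by
  refine ⟨h.ledger, fun P b hb => ?_, fun P => ?_⟩
  · simp only [Adversary.receive] at hb ⊢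
    split_ifs at hb
    · exact h.inbox P b hb
    · rcases List.mem_append.1 hb with hb | hb
      · exact h.inbox P b hb
      · simpa using (List.mem_filter.1 hb).2
  · simp only [Adversary.receive]
    split_ifs
    · exact h.node P
    · exact (h.node P).follow _

theorem Simulates.receive (hs : Sound s R) (h : Simulates e i s s') (a : A.State) (a' : A'.State)
    (send : Fin n → List (EunBlock n N m Tx)) :
    Simulates e i (A.receive corrupt s a send) (A'.receive corrupt s' a'
      fun P => acceptedProj e i ((A.receive corrupt s a send).inbox P)) := by
  classical
  refine ⟨h.round, h.blocks, fun P => ?_, h.trace⟩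
  have hsound := (hs.receive (corrupt := corrupt) a send).inbox P
  -- Received blocks exist in `s`, so their projections exist in `s'` and none is discarded.
  have hfilter : ∀ [DecidablePred fun b => b ∈ s'.blocks.map Prod.snd],
      (acceptedProj e i ((A.receive corrupt s a send).inbox P)).filter
        (fun b => b ∈ s'.blocks.map Prod.snd) =
      acceptedProj e i ((A.receive corrupt s a send).inbox P) := by
    intro _
    refine List.filter_eq_self.2 fun b' hb' => ?_
    obtain ⟨b, h1, h2, h3⟩ := mem_acceptedProj.1 hb'
    obtain ⟨⟨id, b₀⟩, hb, rfl⟩ := List.mem_map.1 (hsound b h1)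
    exact decide_eq_true (List.mem_map.2 ⟨(id, b'), (h.blocks id b').2 ⟨b₀, hb, h3⟩, rfl⟩)
  by_cases hP : P ∈ corrupt
  · simp only [Adversary.receive, if_pos hP]
    exact h.node P
  · have := hfilter
    simp only [Adversary.receive, if_neg hP] at this ⊢
    rw [this]
    exact (h.node P).receive (hs.node P) _

/-! ### The queries of the honest participants -/

theorem won_eq_some {inp : Fin n → Fin m → Tx} {h : Fin n → Fin N} {P : Fin n}
    {b : EunBlock n N m Tx} (hb : A.won corrupt s inp h P = some b) :
    P ∉ corrupt ∧ b = EunBlock.mined ⟨s.round, .participant P⟩ (s.loc P) (inp P)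
      (EunBlock.latest (s.loc P)) (h P) := by
  simp only [Adversary.won, eunomia] at hb
  split_ifs at hb with h1 h2
  exact ⟨h1, (Option.some.inj hb).symm⟩

/-- The synchronized block has the largest clock of all tips, in particular at least that of the
parent, whichever chain the hash value selects. -/
theorem Sound.valid_mined (hs : Sound s R) (id : QueryId n) (P : Fin n) (txs : Fin m → Tx)
    (h : Fin N) :
    (EunBlock.mined id (s.loc P) txs (EunBlock.latest (s.loc P)) h).Valid := by
  obtain ⟨c, hc⟩ := EunBlock.exists_latest_eq (s.loc P : Fin m → EunBlock n N m Tx)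
  exact (EunBlock.valid_mined_iff _ _ _ _ _).2 ⟨(hs.node P).valid _,
    by rw [hc]; exact (hs.node P).valid c, (hs.node P).chain _,
    EunBlock.clock_le_latest _ _⟩

theorem Sound.history_mined (hs : Sound s R) (id : QueryId n) (P : Fin n) (txs : Fin m → Tx)
    (h : Fin N) {b : EunBlock n N m Tx}
    (hb : b = EunBlock.mined id (s.loc P) txs (EunBlock.latest (s.loc P)) h) :
    ∀ c ∈ b.history, c = b ∨ c ∈ s.inbox P := by
  subst hb
  obtain ⟨c₀, hc₀⟩ := EunBlock.exists_latest_eq (s.loc P : Fin m → EunBlock n N m Tx)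
  have hacc : ∀ j, ∀ c ∈ (s.loc P j).history, c ∈ s.inbox P := fun j =>
    ((EunBlock.accepted_iff _ _).1 ((hs.node P).accepted j)).2
  rintro c (hc | hc | hc)
  · exact Or.inl hc
  · exact Or.inr (hacc _ c hc)
  · rw [hc₀] at hc
    exact Or.inr (hacc _ c hc)

/-- Honest blocks are always valid, so their projection depends only on whether the hash value is
low and selects chain `i`. Under `e` this is the success condition of Nakamoto consensus. -/
theorem won_bind_proj (he : ∀ h : Fin N,
      (((e h : Fin N) : ℕ) < D ∧ EunBlock.index m (e h) = i) ↔ (h : ℕ) < d)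
    (hs : Sound s R) (h : Simulates e i s s') (inp : Fin n → Fin m → Tx) (g : Fin n → Fin N)
    (P : Fin n) :
    (A.won corrupt s inp (fun P => e (g P)) P).bind (EunBlock.proj e i) =
      A'.won corrupt s' (fun P => inp P i) g P := by
  by_cases hP : P ∈ corrupt
  · simp only [Adversary.won, if_pos hP]
    rfl
  · have hv := hs.valid_mined ⟨s.round, .participant P⟩ P (inp P) (e (g P))
    have hloc := (h.node P).tip_eq
    by_cases hg : ((g P : Fin N) : ℕ) < d
    · obtain ⟨h1, h2⟩ := (he (g P)).2 hg
      simp only [Adversary.won, hP, eunomia, nakamoto, if_false, if_pos h1, if_pos hg, h.round]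
      refine (EunBlock.proj_of_valid e i hv h2).trans (congrArg some ?_)
      show NakBlock.mined _ ((s.loc P i : EunBlock n N m Tx).toNak e i) _ (e.symm (e (g P))) = _
      rw [e.symm_apply_apply, ← hloc]
    · simp only [Adversary.won, hP, eunomia, nakamoto, if_false, if_neg hg]
      split_ifs with h1
      · have h2 : EunBlock.index m (e (g P)) ≠ i := fun h2 => hg ((he (g P)).1 ⟨h1, h2⟩)
        rw [Option.bind_some, EunBlock.proj, if_neg fun h3 => h2 h3.2]
      · rfl

theorem mem_publish_blocks {n N : ℕ} {Pr : Protocol n N} {A : Adversary Pr}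
    {corrupt : Finset (Fin n)} {s : Config Pr A.State} {w : Fin n → Option Pr.Block} {a : A.State}
    {id : QueryId n} {b : Pr.Block} :
    (id, b) ∈ (A.publish corrupt s w a).blocks ↔
      (id, b) ∈ s.blocks ∨ ∃ P, id = ⟨s.round, .participant P⟩ ∧ w P = some b := by
  simp only [Adversary.publish, List.mem_append, List.mem_flatMap, List.mem_finRange, true_and,
    List.mem_map, Option.mem_toList, Prod.mk.injEq]
  refine or_congr_right (exists_congr fun P => ?_)
  constructor
  · rintro ⟨b', h1, rfl, rfl⟩
    exact ⟨rfl, h1⟩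
  · rintro ⟨rfl, h1⟩
    exact ⟨b, h1, rfl, rfl⟩

theorem Sound.publish (hs : Sound s s.round) (inp : Fin n → Fin m → Tx) (g : Fin n → Fin N)
    (a : A.State) :
    Sound (A.publish corrupt s (A.won corrupt s inp g) a) (s.round + 1) := by
  refine ⟨hs.ledger.append (Nat.le_succ _) fun b hb => ?_, fun P b hb => ?_, fun P => ?_⟩
  · obtain ⟨x, hx, rfl⟩ := List.mem_map.1 hb
    obtain ⟨P, -, hx⟩ := List.mem_flatMap.1 hx
    obtain ⟨b', hb', rfl⟩ := List.mem_map.1 hx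
    rw [Option.mem_toList] at hb'
    obtain ⟨-, rfl⟩ := won_eq_some hb'
    refine ⟨⟨_, _, _, _, _, rfl, Nat.lt_succ_self _⟩, fun c hc => ?_⟩
    exact (hs.history_mined _ P _ _ rfl c hc).imp_right (hs.inbox P c)
  · rcases List.mem_append.1 hb with hb | hb
    · obtain ⟨x, hx, rfl⟩ := List.mem_map.1 (hs.inbox P b hb)
      exact List.mem_map.2 ⟨x, mem_publish_blocks.2 (Or.inl hx), rfl⟩
    · exact List.mem_map.2 ⟨(⟨s.round, .participant P⟩, b),
        mem_publish_blocks.2 (Or.inr ⟨P, rfl, by simpa using hb⟩), rfl⟩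
  · simp only [Adversary.publish]
    split_ifs with hP
    · simp only [Adversary.won, if_pos hP, Option.toList_none, List.append_nil]
      exact hs.node P
    · exact (hs.node P).follow _

/-- The simulated hash values `g` need not be translations of the real ones. It suffices that they
produce the observed blocks `w'` of chain `i`. -/
theorem Simulates.publish (hs : Sound s s.round) (h : Simulates e i s s')
    (inp : Fin n → Fin m → Tx) (g : Fin n → Fin N) (w' : Fin n → Option (NakBlock n N Tx))
    (hw : ∀ P, (A.won corrupt s inp g P).bind (EunBlock.proj e i) = w' P)
    (a : A.State) (a' : A'.State) :
    Simulates e i (A.publish corrupt s (A.won corrupt s inp g) a)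
      (A'.publish corrupt s' w' a') := by
  obtain rfl : (fun P => (A.won corrupt s inp g P).bind (EunBlock.proj e i)) = w' := funext hw
  refine ⟨h.round, fun id b' => ?_, fun P => ?_, h.trace⟩
  · have hE : ∀ b : EunBlock n N m Tx,
        (id, b) ∈ (A.publish corrupt s (A.won corrupt s inp g) a).blocks ↔ (id, b) ∈ s.blocks ∨
          ∃ P, id = ⟨s.round, .participant P⟩ ∧ A.won corrupt s inp g P = some b :=
      fun b => mem_publish_blocks
    refine (mem_publish_blocks.trans (or_congr (h.blocks id b') Iff.rfl)).trans ?_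
    simp only [hE, h.round]
    constructor
    · rintro (⟨b, h1, h2⟩ | ⟨P, rfl, hb⟩)
      · exact ⟨b, Or.inl h1, h2⟩
      · obtain ⟨b, h1, h2⟩ := Option.bind_eq_some_iff.1 hb
        exact ⟨b, Or.inr ⟨P, rfl, h1⟩, h2⟩
    · rintro ⟨b, h1 | ⟨P, rfl, h1⟩, h2⟩
      · exact Or.inl ⟨b, h1, h2⟩
      · exact Or.inr ⟨P, rfl, Option.bind_eq_some_iff.2 ⟨b, h1, h2⟩⟩
  -- Blocks that existed before carry a round number below `s.round`, which is that of the new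
  -- block.
  · have hfresh : ∀ b ∈ A.won corrupt s inp g P, ∀ c ∈ s.inbox P, b ∉ EunBlock.history c := by
      intro b hb c hc hbc
      obtain ⟨id, refs, txs, sync, h', h1, h2⟩ :=
        hs.ledger.round_lt b (hs.ledger.closed c (hs.inbox P c hc) b hbc)
      obtain ⟨-, h3⟩ := won_eq_some hb
      rw [h3] at h1
      injection h1 with h4
      rw [← h4] at h2
      exact lt_irrefl _ h2
    have hacc : ∀ b ∈ A.won corrupt s inp g P, EunBlock.Accepted (s.inbox P ++ [b]) b := by
      intro b hb
      obtain ⟨-, hb⟩ := won_eq_some hb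
      refine (EunBlock.accepted_iff _ _).2
        ⟨by rw [hb]; exact hs.valid_mined _ P _ _, fun c hc => ?_⟩
      rcases hs.history_mined _ P _ _ hb c hc with hc | hc
      · exact List.mem_append_right _ (List.mem_singleton.2 hc)
      · exact List.mem_append_left _ hc
    have key := (h.node P).publish (d := d) (D := D) (hs.node P) _ hfresh hacc
    simp only [Adversary.publish]
    split_ifs with hP
    · have h1 : A.won corrupt s inp g P = none := by simp only [Adversary.won, if_pos hP]
      rw [h1, Option.toList_none, List.append_nil]
      exact (List.append_nil (s'.inbox P : List (NakBlock n N Tx))).symm ▸ h.node P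
    · exact key

/-! ### The end of a round -/

theorem Sound.close (h : Sound s R) : Sound (A.close s) R := ⟨h.ledger, h.inbox, h.node⟩

theorem Simulates.close (hs : Sound s R) (h : Simulates e i s s') :
    Simulates e i (A.close s) (A'.close s') := by
  refine ⟨congrArg (· + 1) h.round, h.blocks, h.node, ?_⟩
  have hE : eunTrace i (A.close s) = eunTrace i s ++
      [fun P => ⟨(s.loc P i : EunBlock n N m Tx).path, {l | ∃ b : EunBlock n N m Tx,
        b ∈ s.inbox P ∧ b.Accepted (s.inbox P) ∧ b.chain = i ∧ b.path = l}⟩] := List.map_append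
  have hK : nakTrace (A'.close s') = nakTrace s' ++
      [fun P => ⟨(s'.loc P : NakBlock n N Tx).path, {l | ∃ b : NakBlock n N Tx,
        b ∈ s'.inbox P ∧ b.Accepted (s'.inbox P) ∧ b.path = l}⟩] := List.map_append
  rw [hE, hK, h.trace]
  congr 2
  funext P
  exact (h.node P).view_eq (hs.node P)

end Execution

/-! ### The queries of the adversary -/

namespace Adversary

variable {n N : ℕ} {Pr : Protocol n N} (A : Adversary Pr)

open Classical in
/-- The state after the adversary's `k`-th query `y` was answered with `h`. -/
noncomputable def record (s : Config Pr A.State) (k : ℕ) (y : Pr.Query) (h : Fin N)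
    (a : A.State) : Config Pr A.State :=
  { s with
    adv := a
    blocks :=
      if ∀ b ∈ Pr.cites y, b ∈ Pr.genesis ∨ b ∈ s.blocks.map Prod.snd then
        s.blocks ++ (Pr.found ⟨s.round, .adversary k⟩ y h).toList.map
          (fun b => (⟨s.round, .adversary k⟩, b))
      else s.blocks }

theorem attack_eq [NeZero N] (s : Config Pr A.State) (k : ℕ) :
    A.attack s k = (A.ask s.adv).bind fun x =>
      match x.2 with
      | none => PMF.pure { s with adv := x.1 }
      | some y => (PMF.uniformOfFintype (Fin N)).bind fun h =>
        (A.learn x.1 h).bind fun a => PMF.pure (A.record s k y h a) := rfl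

theorem mem_record_blocks {A : Adversary Pr} {s : Config Pr A.State} {k : ℕ} {y : Pr.Query}
    {h : Fin N} {a : A.State} {id : QueryId n} {b : Pr.Block} :
    (id, b) ∈ (A.record s k y h a).blocks ↔ (id, b) ∈ s.blocks ∨
      ((∀ b ∈ Pr.cites y, b ∈ Pr.genesis ∨ b ∈ s.blocks.map Prod.snd) ∧
        id = ⟨s.round, .adversary k⟩ ∧ Pr.found ⟨s.round, .adversary k⟩ y h = some b) := by
  simp only [record]
  split_ifs with hc
  · rw [List.mem_append, List.mem_map, and_iff_right hc]
    simp only [Option.mem_toList, Prod.mk.injEq]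
    refine or_congr_right ?_
    constructor
    · rintro ⟨b', h1, rfl, rfl⟩
      exact ⟨rfl, h1⟩
    · rintro ⟨rfl, h1⟩
      exact ⟨b, h1, rfl, rfl⟩
  · exact (or_iff_left fun h => hc h.1).symm

end Adversary

section Execution

variable {n N m : ℕ} [NeZero m] {Tx : Type} {d D : ℕ} {e : Fin N ≃ Fin N} {i : Fin m}
  {A : Adversary (eunomia n N m Tx D)} {A' : Adversary (nakamoto n N Tx d)} {R : ℕ}
  {s : Config (eunomia n N m Tx D) A.State} {s' : Config (nakamoto n N Tx d) A'.State}

theorem Sound.with_adv (hs : Sound s R) (a : A.State) : Sound { s with adv := a } R :=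
  ⟨hs.ledger, hs.inbox, hs.node⟩

theorem Simulates.with_adv (h : Simulates e i s s') (a : A.State) (a' : A'.State) :
    Simulates e i { s with adv := a } { s' with adv := a' } :=
  ⟨h.round, h.blocks, h.node, h.trace⟩

theorem Sound.record (hs : Sound s (s.round + 1)) (k : ℕ) (y : EunQuery n N m Tx) (h : Fin N)
    (a : A.State) : Sound (A.record s k y h a) (s.round + 1) := by
  classical
  refine ⟨?_, fun P b hb => ?_, hs.node⟩
  · simp only [Adversary.record]
    split_ifs with hc
    · refine hs.ledger.append le_rfl fun b hb => ?_
      simp only [eunomia, List.mem_map, Option.mem_toList] at hb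
      obtain ⟨x, ⟨b', hb', rfl⟩, rfl⟩ := hb
      split_ifs at hb'
      obtain rfl := Option.some.inj hb'
      refine ⟨⟨_, _, _, _, _, rfl, Nat.lt_succ_self _⟩, ?_⟩
      have hcite : ∀ b ∈ insert y.sync (Set.range y.refs), ∀ c ∈ b.history,
          c ∈ s.blocks.map Prod.snd := by
        intro b hb c hcb
        rcases hc b hb with ⟨j, rfl⟩ | hb
        · exact absurd hcb (by simp [EunBlock.history])
        · exact hs.ledger.closed b hb c hcb
      rintro c (hc | hc | hc)
      · exact Or.inl hc
      · exact Or.inr (hcite _ (Or.inr ⟨_, rfl⟩) c hc)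
      · exact Or.inr (hcite _ (Or.inl rfl) c hc)
    · exact hs.ledger
  · obtain ⟨x, hx, rfl⟩ := List.mem_map.1 (hs.inbox P b hb)
    exact List.mem_map.2 ⟨x, Adversary.mem_record_blocks.2 (Or.inl hx), rfl⟩

/-- The query `y` can lead to a valid block of chain `i`. -/
structure EunQuery.Admissible (y : EunQuery n N m Tx)
    (blocks : List (QueryId n × EunBlock n N m Tx)) (i : Fin m) : Prop where
  exist : ∀ b ∈ (eunomia n N m Tx 0).cites y,
    b ∈ (eunomia n N m Tx 0).genesis ∨ b ∈ blocks.map Prod.snd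
  parent_valid : (y.refs i).Valid
  sync_valid : y.sync.Valid
  chain : (y.refs i).chain = i
  clock_le : (y.refs i).clock ≤ y.sync.clock

/-- Once the chain is known to be `i`, validity no longer depends on the hash value. The reduction
can thus decide before the answer whether to pass the query on. -/
theorem EunQuery.Admissible.valid {y : EunQuery n N m Tx}
    {blocks : List (QueryId n × EunBlock n N m Tx)} (hy : y.Admissible blocks i) (id : QueryId n)
    {h : Fin N} (hi : EunBlock.index m h = i) :
    (EunBlock.mined id y.refs y.txs y.sync h).Valid := by
  rw [EunBlock.valid_mined_iff, hi]
  exact ⟨hy.parent_valid, hy.sync_valid, hy.chain, hy.clock_le⟩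

theorem eunomia_found_eq_some {id : QueryId n} {y : EunQuery n N m Tx} {h : Fin N}
    {b : EunBlock n N m Tx} : (eunomia n N m Tx D).found id y h = some b ↔
      (h : ℕ) < D ∧ EunBlock.mined id y.refs y.txs y.sync h = b := by
  simp [eunomia]

theorem nakamoto_found_eq_some {id : QueryId n} {y : NakQuery n N Tx} {h : Fin N}
    {b : NakBlock n N Tx} : (nakamoto n N Tx d).found id y h = some b ↔
      (h : ℕ) < d ∧ NakBlock.mined id y.parent y.tx h = b := by
  simp [nakamoto]

/-- Whatever the answer, a block that results is invalid or lies in another chain, so chain `i` does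
not change and no real query is needed. -/
theorem Simulates.record_not_admissible (h : Simulates e i s s') (k : ℕ) (y : EunQuery n N m Tx)
    (hy : ¬ y.Admissible s.blocks i) (g : Fin N) (a : A.State) (a' : A'.State) :
    Simulates e i (A.record s k y g a) { s' with adv := a' } := by
  refine ⟨h.round, fun id b' => ?_, h.node, h.trace⟩
  refine (h.blocks id b').trans (exists_congr fun b => and_congr_left fun hb => ?_)
  refine (Adversary.mem_record_blocks.trans (or_iff_left ?_)).symm
  rintro ⟨h1, -, h2⟩
  obtain ⟨-, rfl⟩ := eunomia_found_eq_some.1 h2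
  obtain ⟨h3, h4, -⟩ := (EunBlock.proj_eq_some_iff e i).1 hb
  replace h4 : EunBlock.index m g = i := h4
  rw [EunBlock.valid_mined_iff, h4] at h3
  exact hy ⟨h1, h3.1, h3.2.1, h3.2.2.1, h3.2.2.2⟩

theorem Simulates.record_admissible (he : ∀ h : Fin N,
      (((e h : Fin N) : ℕ) < D ∧ EunBlock.index m (e h) = i) ↔ (h : ℕ) < d)
    (h : Simulates e i s s') (k : ℕ) (y : EunQuery n N m Tx)
    (hy : y.Admissible s.blocks i) (g : Fin N) (a : A.State) (a' : A'.State) :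
    Simulates e i (A.record s k y (e g) a)
      (A'.record s' k (⟨(y.refs i).toNak e i, y.txs i⟩ : NakQuery n N Tx) g a') := by
  refine ⟨h.round, fun id b' => ?_, h.node, h.trace⟩
  -- The parent is a genesis block or exists in `s`, hence its projection may be cited in `s'`.
  have hex : ∀ b ∈ (nakamoto n N Tx d).cites
      (⟨(y.refs i).toNak e i, y.txs i⟩ : NakQuery n N Tx),
      b ∈ (nakamoto n N Tx d).genesis ∨ b ∈ s'.blocks.map Prod.snd := by
    rintro b rfl
    rcases hy.exist (y.refs i) (Or.inr ⟨i, rfl⟩) with ⟨j, hj⟩ | hb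
    · left
      show (y.refs i).toNak e i = NakBlock.genesis
      rw [← hj]
      rfl
    · obtain ⟨⟨id, b⟩, h1, h2⟩ := List.mem_map.1 hb
      exact Or.inr (List.mem_map.2 ⟨(id, (y.refs i).toNak e i), (h.blocks id _).2 ⟨b, h1, by
        rw [show b = y.refs i from h2]
        exact EunBlock.proj_of_valid e i hy.parent_valid hy.chain⟩, rfl⟩)
  have hE : ∀ b : EunBlock n N m Tx, (id, b) ∈ (A.record s k y (e g) a).blocks ↔ _ :=
    fun b => Adversary.mem_record_blocks
  simp only [hE]
  refine (Adversary.mem_record_blocks.trans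
    (or_congr (h.blocks id b') (and_congr_right' (and_congr_right' nakamoto_found_eq_some)))).trans ?_
  constructor
  · rintro (⟨b, h1, h2⟩ | ⟨-, rfl, h2, rfl⟩)
    · exact ⟨b, Or.inl h1, h2⟩
    · obtain ⟨h3, h4⟩ := (he g).2 h2
      refine ⟨_, Or.inr ⟨hy.exist, by rw [h.round], eunomia_found_eq_some.2 ⟨h3, rfl⟩⟩, ?_⟩
      rw [EunBlock.proj_of_valid e i (hy.valid _ h4) h4, EunBlock.toNak, e.symm_apply_apply,
        h.round]
  · rintro ⟨b, h1 | ⟨-, rfl, h1⟩, h2⟩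
    · exact Or.inl ⟨b, h1, h2⟩
    · obtain ⟨h3, rfl⟩ := eunomia_found_eq_some.1 h1
      obtain ⟨-, h4, rfl⟩ := (EunBlock.proj_eq_some_iff e i).1 h2
      refine Or.inr ⟨hex, by rw [h.round], (he g).1 ⟨h3, h4⟩, ?_⟩
      rw [EunBlock.toNak, e.symm_apply_apply, h.round]

end Execution

/-! ## The simulating adversary -/

/-- The state of an adversary against Nakamoto consensus that runs an execution of Eunomia. -/
structure SimState (n N m : ℕ) [NeZero m] (Tx : Type) (D : ℕ) (S : Type) where
  /-- the simulated global state, before the last round is closed -/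
  cfg : Config (eunomia n N m Tx D) S
  /-- the inputs of the participants in this round; none before the first round -/
  inp : Option (Fin n → Fin m → Tx)
  /-- the number of adversarial queries simulated in this round -/
  count : ℕ
  /-- the query of the simulated adversary that waits for its answer -/
  pending : Option (EunQuery n N m Tx)

namespace Adversary

variable {n N m : ℕ} [NeZero N] [NeZero m] {Tx : Type} {d D : ℕ}

/-- The simulated global state at the end of the last round. -/
noncomputable def boundary (A : Adversary (eunomia n N m Tx D)) (st : SimState n N m Tx D A.State) :
    Config (eunomia n N m Tx D) A.State :=
  -- The adversary makes no move at the end of a round, so closing is postponed to its next move.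
  -- Missing inputs mean that there is no round to close.
  if st.inp.isSome then A.close st.cfg else A.initial

/-- Simulation of the delivery: blocks of chain `i` are delivered when they are accepted. -/
noncomputable def simPlan (A : Adversary (eunomia n N m Tx D)) (corrupt : Finset (Fin n))
    (e : Fin N ≃ Fin N) (i : Fin m) (st : SimState n N m Tx D A.State) :
    PMF (SimState n N m Tx D A.State × (Fin n → List (NakBlock n N Tx)) × (Fin n → Tx)) :=
  (A.plan (A.boundary st).adv).map fun x =>
    (⟨A.receive corrupt (A.boundary st) x.1 x.2.1, some x.2.2, 0, none⟩,
      fun P => acceptedProj e i ((A.receive corrupt (A.boundary st) x.1 x.2.1).inbox P),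
      fun P => x.2.2 P i)

/-- The blocks of chain `i` that the simulated honest participants find. -/
noncomputable def wonProj (A : Adversary (eunomia n N m Tx D)) (corrupt : Finset (Fin n))
    (e : Fin N ≃ Fin N) (i : Fin m) (s : Config (eunomia n N m Tx D) A.State)
    (inp : Fin n → Fin m → Tx) (h : Fin n → Fin N) (P : Fin n) : Option (NakBlock n N Tx) :=
  (A.won corrupt s inp h P).bind (EunBlock.proj e i)

/-- Simulation of the queries of the honest participants: their hash values are sampled given the
blocks of chain `i` that were found. -/
noncomputable def simHear (A : Adversary (eunomia n N m Tx D)) (corrupt : Finset (Fin n))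
    (e : Fin N ≃ Fin N) (i : Fin m) (st : SimState n N m Tx D A.State)
    (w' : Fin n → Option (NakBlock n N Tx)) : PMF (SimState n N m Tx D A.State) :=
  match st.inp with
  | none => PMF.pure st
  | some inp => (PMF.uniformFibre (A.wonProj corrupt e i st.cfg inp) w').bind fun h =>
      (A.hear st.cfg.adv (A.won corrupt st.cfg inp h)).map fun a =>
        { st with cfg := A.publish corrupt st.cfg (A.won corrupt st.cfg inp h) a }

open Classical in
/-- What is done with a query of the simulated adversary: it is made if it may lead to a valid
block of chain `i`; otherwise its answer is sampled. -/
noncomputable def simReply (A : Adversary (eunomia n N m Tx D)) (e : Fin N ≃ Fin N) (i : Fin m)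
    (st : SimState n N m Tx D A.State) (x : A.State × Option (EunQuery n N m Tx)) :
    PMF (SimState n N m Tx D A.State × Option (NakQuery n N Tx)) :=
  match x.2 with
  -- A declined or privately answered query still uses up its number, so that later queries have the
  -- same `QueryId` in both executions.
  | none => PMF.pure ({ st with cfg := { st.cfg with adv := x.1 }, count := st.count + 1 }, none)
  | some y =>
    if y.Admissible st.cfg.blocks i then
      PMF.pure ({ st with cfg := { st.cfg with adv := x.1 }, pending := some y },
        some ⟨(y.refs i).toNak e i, y.txs i⟩)
    else (PMF.uniformOfFintype (Fin N)).bind fun h => (A.learn x.1 h).map fun a =>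
      ({ st with cfg := A.record st.cfg st.count y h a, count := st.count + 1 }, none)

/-- Simulation of the answer to a query of the adversary. -/
noncomputable def simLearn (A : Adversary (eunomia n N m Tx D)) (e : Fin N ≃ Fin N)
    (st : SimState n N m Tx D A.State) (h' : Fin N) : PMF (SimState n N m Tx D A.State) :=
  match st.pending with
  | none => PMF.pure st
  | some y => (A.learn st.cfg.adv (e h')).map fun a =>
      { st with cfg := A.record st.cfg st.count y (e h') a, count := st.count + 1 }

/-- The adversary against Nakamoto consensus that simulates `A` against Eunomia. -/
noncomputable def reduction (A : Adversary (eunomia n N m Tx D)) (d : ℕ) (corrupt : Finset (Fin n))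
    (e : Fin N ≃ Fin N) (i : Fin m) : Adversary (nakamoto n N Tx d) where
  State := SimState n N m Tx D A.State
  start := ⟨A.initial, none, 0, none⟩
  plan := A.simPlan corrupt e i
  hear := A.simHear corrupt e i
  ask st := (A.ask st.cfg.adv).bind (A.simReply e i st)
  learn := A.simLearn e

end Adversary

/-! ### Correctness of the reduction: coupling the two executions -/

section Reduction

open PMF

variable {n N m : ℕ} [NeZero N] [NeZero m] {Tx : Type} {d D : ℕ}
  {A : Adversary (eunomia n N m Tx D)} {corrupt : Finset (Fin n)} {e : Fin N ≃ Fin N} {i : Fin m}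

/-- The reduction simulates the execution `s` correctly up to its `k`-th query in this round. -/
structure Attacking (s : Config (eunomia n N m Tx D) A.State)
    (s' : Config (nakamoto n N Tx d) (A.reduction d corrupt e i).State) (k : ℕ) : Prop where
  cfg : SimState.cfg s'.adv = s
  started : (SimState.inp s'.adv).isSome
  count : SimState.count s'.adv = k
  -- Blocks of the current round exist already, hence the bound `s.round + 1`; closing the round
  -- turns it into the bound in `Matching`.
  sound : Sound s (s.round + 1)
  simulates : Simulates e i s s'

/-- The reduction simulates the execution `s` correctly up to the end of the round. -/
structure Matching (s : Config (eunomia n N m Tx D) A.State)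
    (s' : Config (nakamoto n N Tx d) (A.reduction d corrupt e i).State) : Prop where
  cfg : A.boundary s'.adv = s
  sound : Sound s s.round
  simulates : Simulates e i s s'

theorem matching_initial : Matching A.initial (A.reduction d corrupt e i).initial :=
  ⟨rfl, sound_initial, simulates_initial⟩

theorem Attacking.close {s : Config (eunomia n N m Tx D) A.State}
    {s' : Config (nakamoto n N Tx d) (A.reduction d corrupt e i).State} {k : ℕ}
    (h : Attacking s s' k) : Matching (A.close s) ((A.reduction d corrupt e i).close s') :=
  ⟨(if_pos h.started).trans (congrArg A.close h.cfg), h.sound.close,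
    h.simulates.close h.sound⟩

/-- For a query that is passed on, the two oracle answers are coupled through `e`; for one that is
not, the oracle answer in Eunomia is coupled with the private sample. -/
theorem Attacking.attack (he : ∀ h : Fin N,
      (((e h : Fin N) : ℕ) < D ∧ EunBlock.index m (e h) = i) ↔ (h : ℕ) < d)
    {s : Config (eunomia n N m Tx D) A.State}
    {s' : Config (nakamoto n N Tx d) (A.reduction d corrupt e i).State} {k : ℕ}
    (h : Attacking s s' k) :
    Coupled (fun t t' => Attacking t t' (k + 1)) (A.attack s k)
      ((A.reduction d corrupt e i).attack s' k) := by
  obtain ⟨rfl, h1, rfl, h2, h3⟩ := h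
  rw [Adversary.attack_eq, Adversary.attack_eq]
  refine Coupled.bind_bind_right (q := A.ask (SimState.cfg s'.adv).adv)
    (f := A.simReply e i s'.adv) rfl ?_
  refine (Coupled.refl _).bind ?_
  rintro ⟨a, y⟩ _ rfl
  cases y with
  | none =>
    exact Coupled.pure_bind_right rfl
      (Coupled.pure ⟨rfl, h1, rfl, h2.with_adv a, h3.with_adv a _⟩)
  | some y =>
    by_cases hy : EunQuery.Admissible y (SimState.cfg s'.adv).blocks i
    · refine Coupled.pure_bind_right (if_pos hy) ?_
      refine (coupled_uniformOfFintype e).bind ?_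
      rintro _ g rfl
      refine Coupled.map_bind_right (q := A.learn a (e g)) rfl ?_
      refine (Coupled.refl _).bind ?_
      rintro b _ rfl
      exact Coupled.pure ⟨rfl, h1, rfl, h2.record _ y (e g) b,
        h3.record_admissible he _ y hy g b _⟩
    · refine Coupled.bind_bind_right (if_neg hy) ?_
      refine (Coupled.refl _).bind ?_
      rintro g _ rfl
      refine Coupled.map_bind_right rfl ?_
      refine (Coupled.refl _).bind ?_
      rintro b _ rfl
      exact Coupled.pure ⟨rfl, h1, rfl, h2.record _ y g b,
        h3.record_not_admissible _ y hy g b _⟩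

theorem Attacking.attacks (he : ∀ h : Fin N,
      (((e h : Fin N) : ℕ) < D ∧ EunBlock.index m (e h) = i) ↔ (h : ℕ) < d)
    {s : Config (eunomia n N m Tx D) A.State}
    {s' : Config (nakamoto n N Tx d) (A.reduction d corrupt e i).State}
    (h : Attacking s s' 0) (q : ℕ) :
    Coupled (fun t t' => Attacking t t' q) (A.attacks s q)
      ((A.reduction d corrupt e i).attacks s' q) := by
  induction q with
  | zero => exact Coupled.pure h
  | succ q ih => exact ih.bind fun t t' ht => ht.attack he

theorem Matching.step (he : ∀ h : Fin N,
      (((e h : Fin N) : ℕ) < D ∧ EunBlock.index m (e h) = i) ↔ (h : ℕ) < d)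
    {s : Config (eunomia n N m Tx D) A.State}
    {s' : Config (nakamoto n N Tx d) (A.reduction d corrupt e i).State}
    (h : Matching s s') (q : ℕ) :
    Coupled Matching (A.step corrupt q s) ((A.reduction d corrupt e i).step corrupt q s') := by
  obtain ⟨rfl, h2, h3⟩ := h
  refine Coupled.map_bind_right (q := A.plan (A.boundary s'.adv).adv) rfl ?_
  refine (Coupled.refl _).bind ?_
  rintro ⟨a, send, inp⟩ _ rfl
  have hs := h2.receive (corrupt := corrupt) a send
  have hsim := h3.receive h2 (corrupt := corrupt) a
    (⟨A.receive corrupt (A.boundary s'.adv) a send, some inp, 0, none⟩ :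
      SimState n N m Tx D A.State) send
  -- All honest queries of the round are treated at once: `e` acts in each coordinate, and the
  -- observation is the family of blocks found in chain `i`.
  refine coupled_bind_uniformFibre (Equiv.piCongrRight fun _ => e)
    ((A.reduction d corrupt e i).won corrupt _ fun P => inp P i)
    (A.wonProj corrupt e i (A.receive corrupt (A.boundary s'.adv) a send) inp)
    (fun g => funext fun P => won_bind_proj he hs hsim inp g P) _
    (fun g' => PMF.bind_bind _ _ _) fun g' g hg => ?_
  refine Coupled.map_bind_right rfl ?_
  refine (Coupled.refl _).bind ?_
  rintro b _ rfl
  refine (Attacking.attacks he ?_ q).map fun t t' ht => ht.close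
  exact ⟨rfl, rfl, rfl, hs.publish inp g b, hsim.publish hs inp g _ (congrFun hg) b _⟩

theorem coupled_exec (he : ∀ h : Fin N,
      (((e h : Fin N) : ℕ) < D ∧ EunBlock.index m (e h) = i) ↔ (h : ℕ) < d) (q R : ℕ) :
    Coupled Matching (A.exec corrupt q R) ((A.reduction d corrupt e i).exec corrupt q R) := by
  induction R with
  | zero => exact Coupled.pure matching_initial
  | succ R ih => exact ih.bind fun s s' h => h.step he q

/-- The delay bound of Eunomia covers the synchronized blocks as well, so in time the block is not
only received but accepted. The reduction has then delivered it with its ancestors. -/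
theorem Adversary.DelayBounded.reduction (he : ∀ h : Fin N,
      (((e h : Fin N) : ℕ) < D ∧ EunBlock.index m (e h) = i) ↔ (h : ℕ) < d) {q Δ : ℕ}
    (hA : A.DelayBounded corrupt q Δ) : (A.reduction d corrupt e i).DelayBounded corrupt q Δ := by
  intro R s' hs' t P b' hb' ht Q hQ c' hc'
  obtain ⟨s, hs, -, -, hsim⟩ := (coupled_exec he q R).exists_of_mem_support hs'
  obtain ⟨b, hb, hbb⟩ := (hsim.blocks _ b').1 hb'
  rw [hsim.round] at ht
  have hin := hA R s hs t P b hb ht Q hQ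
  obtain ⟨hv, hc, rfl⟩ := (EunBlock.proj_eq_some_iff e i).1 hbb
  have hacc : b.Accepted (s.inbox Q) := (EunBlock.accepted_iff _ _).2 ⟨hv, hin⟩
  exact ((hsim.node Q).mem_iff c').2 (hacc.toNak_history e i hc hc')

theorem exists_reduction {d Δ q : ℕ} (hd : m * d ≤ N) (i : Fin m)
    (A : Adversary (eunomia n N m Tx (m * d))) (hA : A.DelayBounded corrupt q Δ) :
    ∃ A' : Adversary (nakamoto n N Tx d), A'.DelayBounded corrupt q Δ ∧
      ∀ R : ℕ, (A.exec corrupt q R).map (eunTrace i) = (A'.exec corrupt q R).map nakTrace := by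
  obtain ⟨e, he⟩ := exists_equiv_hash i hd
  exact ⟨A.reduction d corrupt e i, hA.reduction he, fun R =>
    (coupled_exec he q R).map_eq fun s s' h => h.simulates.trace.symm⟩

end Reduction

theorem lemma1 (n N m d Δ : ℕ) [NeZero N] [NeZero m] (Tx : Type) (ρ p : ℝ)
    (hmN : m ∣ N) (hp : p = (d : ℝ) / N) (hmp : (m : ℝ) * p ≤ 1) (i : Fin m) :
    -- a hash value is low enough, and belongs to chain `i`: two independent events
    hashProb {h : Fin N | (h : ℕ) < m * d} = ENNReal.ofReal (m * p) ∧
    hashProb {h : Fin N | EunBlock.index m h = i} = ENNReal.ofReal (1 / m) ∧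
    hashProb {h : Fin N | (h : ℕ) < m * d ∧ EunBlock.index m h = i} =
      hashProb {h : Fin N | (h : ℕ) < m * d} * hashProb {h : Fin N | EunBlock.index m h = i} ∧
    -- a query yields a block of chain `i`, respectively of the single chain, with probability `p`
    (∀ (id : QueryId n) (x : EunQuery n N m Tx),
      hashProb {h | ∃ b : EunBlock n N m Tx,
        (eunomia n N m Tx (m * d)).found id x h = some b ∧ b.chain = i} = ENNReal.ofReal p) ∧
    (∀ (id : QueryId n) (x : NakQuery n N Tx),
      hashProb {h | ∃ b : NakBlock n N Tx,
        (nakamoto n N Tx d).found id x h = some b} = ENNReal.ofReal p) ∧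
    -- the parent is fixed by the query and the hash value
    (∀ (id : QueryId n) (x : EunQuery n N m Tx) (h : Fin N) (b : EunBlock n N m Tx),
      (eunomia n N m Tx (m * d)).found id x h = some b → b.parent? = some (x.refs b.chain)) ∧
    (∀ (id : QueryId n) (x : NakQuery n N Tx) (h : Fin N) (b : NakBlock n N Tx),
      (nakamoto n N Tx d).found id x h = some b → b.parent? = some x.parent) ∧
    -- the reduction: each adversary is matched by one against Nakamoto consensus
    (∀ corrupt : Finset (Fin n), (corrupt.card : ℝ) ≤ ρ * n →
      ∀ A : Adversary (eunomia n N m Tx (m * d)), A.DelayBounded corrupt ⌊ρ * n⌋₊ Δ →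
        ∃ A' : Adversary (nakamoto n N Tx d), A'.DelayBounded corrupt ⌊ρ * n⌋₊ Δ ∧
          ∀ R : ℕ, (A.exec corrupt ⌊ρ * n⌋₊ R).map (eunTrace i) =
            (A'.exec corrupt ⌊ρ * n⌋₊ R).map nakTrace) ∧
    -- chain `i` inherits every property of the single chain of Nakamoto consensus
    (∀ (R : ℕ) (good : Finset (Fin n) → Set (ChainTrace n Tx)) (ε : ENNReal),
      Guarantees (nakamoto n N Tx d) nakTrace ρ Δ R good ε →
        Guarantees (eunomia n N m Tx (m * d)) (eunTrace i) ρ Δ R good ε) := by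
  have hN : (0 : ℝ) < N := by exact_mod_cast Nat.pos_of_ne_zero (NeZero.ne N)
  have hm : (0 : ℝ) < m := by exact_mod_cast Nat.pos_of_ne_zero (NeZero.ne m)
  have hd : m * d ≤ N := by
    rw [hp, ← mul_div_assoc, div_le_one hN] at hmp
    exact_mod_cast hmp
  have hdN : d ≤ N :=
    (Nat.le_mul_of_pos_left d (Nat.pos_of_ne_zero (NeZero.ne m))).trans hd
  have hlow : hashProb {h : Fin N | (h : ℕ) < m * d} = ENNReal.ofReal (m * p) :=
    hashProb_setOf _ (card_val_lt hd) (by rw [hp]; push_cast; ring)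
  have hindex : hashProb {h : Fin N | EunBlock.index m h = i} = ENNReal.ofReal (1 / m) :=
    hashProb_setOf _ (card_index_eq hmN i) (by
      rw [Nat.cast_div hmN hm.ne']
      field_simp)
  have hboth : hashProb {h : Fin N | (h : ℕ) < m * d ∧ EunBlock.index m h = i} =
      ENNReal.ofReal p := hashProb_setOf _ (card_lt_and_index_eq i hd) hp
  have hred : ∀ corrupt : Finset (Fin n), (corrupt.card : ℝ) ≤ ρ * n →
      ∀ A : Adversary (eunomia n N m Tx (m * d)), A.DelayBounded corrupt ⌊ρ * n⌋₊ Δ →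
        ∃ A' : Adversary (nakamoto n N Tx d), A'.DelayBounded corrupt ⌊ρ * n⌋₊ Δ ∧
          ∀ R : ℕ, (A.exec corrupt ⌊ρ * n⌋₊ R).map (eunTrace i) =
            (A'.exec corrupt ⌊ρ * n⌋₊ R).map nakTrace :=
    fun corrupt _ A hA => exists_reduction hd i A hA
  refine ⟨hlow, hindex, ?_, fun id x => ?_, fun id x => ?_, fun id x h b hb => ?_,
    fun id x h b hb => ?_, hred, fun R good ε hG corrupt hcorrupt A hA => ?_⟩
  · rw [hboth, hlow, hindex, ← ENNReal.ofReal_mul' (by positivity)]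
    congr 1
    field_simp
  · rw [← hboth]
    congr 1
    ext h
    constructor
    · rintro ⟨b, hb, hc⟩
      obtain ⟨h1, rfl⟩ := eunomia_found_eq_some.1 hb
      exact ⟨h1, hc⟩
    · rintro ⟨h1, h2⟩
      exact ⟨_, eunomia_found_eq_some.2 ⟨h1, rfl⟩, h2⟩
  · rw [← hashProb_setOf (fun h : Fin N => (h : ℕ) < d) (card_val_lt hdN) hp]
    congr 1
    ext h
    exact ⟨fun ⟨b, hb⟩ => (nakamoto_found_eq_some.1 hb).1,
      fun h1 => ⟨_, nakamoto_found_eq_some.2 ⟨h1, rfl⟩⟩⟩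
  · obtain ⟨-, rfl⟩ := eunomia_found_eq_some.1 hb
    rfl
  · obtain ⟨-, rfl⟩ := nakamoto_found_eq_some.1 hb
    rfl
  · obtain ⟨A', hA', htrace⟩ := hred corrupt hcorrupt A hA
    -- The violation is the preimage of the complement of `good corrupt` under the trace, so its
    -- probability depends only on the law of the trace.
    have h1 := PMF.toOuterMeasure_map_apply (eunTrace i) (A.exec corrupt ⌊ρ * n⌋₊ R)
      (good corrupt)ᶜ
    rw [htrace R, PMF.toOuterMeasure_map_apply] at h1
    exact h1.symm.trans_le (hG corrupt hcorrupt A' hA')
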